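/- **Proposition 4.3.** Let $A$ be a $\sigma$-unital C$^*$-algebra (one with a countable approximate unit), $G$ a finite abelian group, and $\alpha : G \to \mathrm{Aut}(A)$ an action. Then (i) $\alpha$ has the Rohlin property if and only if the dual action $\hat\alpha$ is approximately representable; (ii) $\alpha$ is approximately representable if and only if the dual action $\hat\alpha$ has the Rohlin property. Here the following definitions are used. For a $\sigma$-unital C$^*$-algebra $B$ put $B^\infty := \ell^\infty(\mathbb{N},B)/c_0(B)$, where $B \subset B^\infty$ as classes of constant sequences, $B_\infty := B^\infty \cap B'$, $\mathrm{Ann}(B,B^\infty) := \{x \in B_\infty : xb = 0 \text{ for all } b \in B\}$ and $F(B) := B_\infty/\mathrm{Ann}(B,B^\infty)$, a unital C$^*$-algebra. Automorphisms of $B$ induce automorphisms of $F(B)$, denoted by the same symbols. An action $\beta$ of a finite group $H$ on $B$ has the *Rohlin property* if there are mutually orthogonal projections $(e_h)_{h\in H}$ in $F(B)$ with $\sum_{h\in H} e_h = 1$ and $\beta_g(e_h) = e_{gh}$ for all $g,h\in H$. An action $\beta$ of a finite abelian group $H$ on $B$, with fixed point algebra $B^\beta$, is *approximately representable* if there are elements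 $w(h) \in (B^\beta)_\infty$, $h\in H$, such that $h \mapsto [w(h)]$ is a unitary representation of $H$ on $F(B^\beta)$ (a homomorphism into the unitary group of $F(B^\beta)$) and $\beta_h(b) = w(h)\, b\, w(h)^*$ in $B^\infty$ for all $b\in B$ and $h\in H$. The crossed product $A\rtimes_\alpha G$ is the C$^*$-algebra of all operators $\sum_{g\in G} a_g\lambda_g$ ($a_g \in A$) on the Hilbert $A$-module $\ell^2(G,A)$, where $(a\xi)(h) = \alpha_{h^{-1}}(a)\xi(h)$ and $(\lambda_g\xi)(h) = \xi(g^{-1}h)$. The dual action $\hat\alpha$ of the group $\hat G = \mathrm{Hom}(G,\mathbb{T})$ on it is given by $\hat\alpha_\gamma(\sum_g a_g\lambda_g) = \sum_g \gamma(g)\,a_g\lambda_g$. -/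

import Mathlib

open scoped ENNReal

noncomputable section

namespace RohlinDuality

/-! ### Quotients of complex star-algebras by two-sided star-ideals -/

section StarIdeal

/-- A two-sided, self-adjoint ideal of a (not necessarily unital) complex star-algebra. -/
structure StarIdeal (R : Type*) [NonUnitalRing R] [StarRing R] [Module ℂ R] extends
    Submodule ℂ R where
  mul_mem_left' : ∀ (r : R) {x : R}, x ∈ carrier → r * x ∈ carrier
  mul_mem_right' : ∀ (r : R) {x : R}, x ∈ carrier → x * r ∈ carrier
  star_mem' : ∀ {x : R}, x ∈ carrier → star x ∈ carrier

namespace StarIdeal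

variable {R S : Type*} [NonUnitalRing R] [StarRing R] [Module ℂ R]
  [NonUnitalRing S] [StarRing S] [Module ℂ S]

/-- The quotient of a star-algebra by a two-sided star-ideal. -/
def Quot (I : StarIdeal R) : Type _ := R ⧸ I.toSubmodule

variable (I : StarIdeal R) (J : StarIdeal S)

instance : AddCommGroup I.Quot := inferInstanceAs (AddCommGroup (R ⧸ I.toSubmodule))

instance : Module ℂ I.Quot := inferInstanceAs (Module ℂ (R ⧸ I.toSubmodule))

/-- The class of an element in the quotient, as a linear map. -/
def mkₗ : R →ₗ[ℂ] I.Quot := I.toSubmodule.mkQ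

theorem mkₗ_surjective : Function.Surjective I.mkₗ := Submodule.mkQ_surjective _

theorem mkₗ_eq_iff {x y : R} : I.mkₗ x = I.mkₗ y ↔ x - y ∈ I.toSubmodule :=
  Submodule.Quotient.eq _

instance : Mul I.Quot where
  mul := Quotient.map₂ (· * ·) fun x x' hx y y' hy => by
    have hx : x - x' ∈ I.toSubmodule := (Submodule.quotientRel_def _).1 hx
    have hy : y - y' ∈ I.toSubmodule := (Submodule.quotientRel_def _).1 hy
    refine (Submodule.quotientRel_def _).2 ?_
    have h : x * y - x' * y' = (x - x') * y + x' * (y - y') := by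
      rw [sub_mul, mul_sub]; abel
    rw [h]
    exact I.toSubmodule.add_mem (I.mul_mem_right' y hx) (I.mul_mem_left' x' hy)

instance : Star I.Quot where
  star := Quotient.map star fun x x' hx => by
    have hx : x - x' ∈ I.toSubmodule := (Submodule.quotientRel_def _).1 hx
    refine (Submodule.quotientRel_def _).2 ?_
    rw [← star_sub]
    exact I.star_mem' hx

theorem mkₗ_mul (x y : R) : I.mkₗ (x * y) = I.mkₗ x * I.mkₗ y := rfl

theorem mkₗ_star (x : R) : I.mkₗ (star x) = star (I.mkₗ x) := rfl

instance : NonUnitalRing I.Quot where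
  left_distrib a b c := by
    obtain ⟨a, rfl⟩ := I.mkₗ_surjective a
    obtain ⟨b, rfl⟩ := I.mkₗ_surjective b
    obtain ⟨c, rfl⟩ := I.mkₗ_surjective c
    rw [← map_add, ← mkₗ_mul, mul_add, map_add, mkₗ_mul, mkₗ_mul]
  right_distrib a b c := by
    obtain ⟨a, rfl⟩ := I.mkₗ_surjective a
    obtain ⟨b, rfl⟩ := I.mkₗ_surjective b
    obtain ⟨c, rfl⟩ := I.mkₗ_surjective c
    rw [← map_add, ← mkₗ_mul, add_mul, map_add, mkₗ_mul, mkₗ_mul]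
  zero_mul a := by
    obtain ⟨a, rfl⟩ := I.mkₗ_surjective a
    rw [← map_zero I.mkₗ, ← mkₗ_mul, zero_mul]
  mul_zero a := by
    obtain ⟨a, rfl⟩ := I.mkₗ_surjective a
    rw [← map_zero I.mkₗ, ← mkₗ_mul, mul_zero]
  mul_assoc a b c := by
    obtain ⟨a, rfl⟩ := I.mkₗ_surjective a
    obtain ⟨b, rfl⟩ := I.mkₗ_surjective b
    obtain ⟨c, rfl⟩ := I.mkₗ_surjective c
    simp only [← mkₗ_mul, mul_assoc]

instance : StarRing I.Quot where
  star_involutive a := by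
    obtain ⟨a, rfl⟩ := I.mkₗ_surjective a
    simp only [← mkₗ_star, star_star]
  star_mul a b := by
    obtain ⟨a, rfl⟩ := I.mkₗ_surjective a
    obtain ⟨b, rfl⟩ := I.mkₗ_surjective b
    simp only [← mkₗ_star, ← mkₗ_mul, star_mul]
  star_add a b := by
    obtain ⟨a, rfl⟩ := I.mkₗ_surjective a
    obtain ⟨b, rfl⟩ := I.mkₗ_surjective b
    simp only [← mkₗ_star, ← map_add, star_add]

instance [IsScalarTower ℂ R R] : IsScalarTower ℂ I.Quot I.Quot where
  smul_assoc c a b := by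
    obtain ⟨a, rfl⟩ := I.mkₗ_surjective a
    obtain ⟨b, rfl⟩ := I.mkₗ_surjective b
    simp only [smul_eq_mul, ← map_smul, ← mkₗ_mul, smul_mul_assoc]

instance [SMulCommClass ℂ R R] : SMulCommClass ℂ I.Quot I.Quot where
  smul_comm c a b := by
    obtain ⟨a, rfl⟩ := I.mkₗ_surjective a
    obtain ⟨b, rfl⟩ := I.mkₗ_surjective b
    simp only [smul_eq_mul, ← map_smul, ← mkₗ_mul, mul_smul_comm]

instance [StarModule ℂ R] : StarModule ℂ I.Quot where
  star_smul c a := by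
    obtain ⟨a, rfl⟩ := I.mkₗ_surjective a
    simp only [← mkₗ_star, ← map_smul, star_smul]

/-- The quotient homomorphism. -/
def proj : R →⋆ₙₐ[ℂ] I.Quot where
  toFun := I.mkₗ
  map_smul' := map_smul I.mkₗ
  map_zero' := map_zero I.mkₗ
  map_add' := map_add I.mkₗ
  map_mul' := I.mkₗ_mul
  map_star' := I.mkₗ_star

theorem proj_surjective : Function.Surjective I.proj := I.mkₗ_surjective

theorem proj_eq_iff {x y : R} : I.proj x = I.proj y ↔ x - y ∈ I.toSubmodule := I.mkₗ_eq_iff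

variable {I J}

/-- The homomorphism between quotients induced by a homomorphism mapping `I` into `J`. -/
def Quot.map (f : R →⋆ₙₐ[ℂ] S) (hf : ∀ x ∈ I.toSubmodule, f x ∈ J.toSubmodule) :
    I.Quot →⋆ₙₐ[ℂ] J.Quot :=
  let L : I.Quot →ₗ[ℂ] J.Quot :=
    I.toSubmodule.mapQ J.toSubmodule (f : R →ₗ[ℂ] S) hf
  have hL (x : R) : L (I.mkₗ x) = J.mkₗ (f x) := rfl
  { toFun := L
    map_smul' := map_smul L
    map_zero' := map_zero L
    map_add' := map_add L
    map_mul' := fun a b => by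
      obtain ⟨a, rfl⟩ := I.mkₗ_surjective a
      obtain ⟨b, rfl⟩ := I.mkₗ_surjective b
      rw [← mkₗ_mul, hL, hL, hL, map_mul, mkₗ_mul]
    map_star' := fun a => by
      obtain ⟨a, rfl⟩ := I.mkₗ_surjective a
      rw [← mkₗ_star, hL, hL, map_star, mkₗ_star] }

@[simp] theorem Quot.map_proj (f : R →⋆ₙₐ[ℂ] S) (hf : ∀ x ∈ I.toSubmodule, f x ∈ J.toSubmodule)
    (x : R) : Quot.map f hf (I.proj x) = J.proj (f x) := rfl

end StarIdeal

end StarIdeal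

/-! ### Sequence algebras -/

section Sequences

variable (A : Type*) [NonUnitalCStarAlgebra A]
variable {A} {B : Type*} [NonUnitalCStarAlgebra B]

/-- `c₀(A)`, the ideal of null sequences in `ℓ^∞(ℕ, A)`. -/
def c0 (A : Type*) [NonUnitalCStarAlgebra A] : StarIdeal (lp (fun _ : ℕ => A) ∞) where
  carrier := {x | Filter.Tendsto (fun n => ‖x n‖) Filter.atTop (nhds 0)}
  zero_mem' := by simp
  add_mem' {x y} hx hy := by
    refine squeeze_zero (fun n => norm_nonneg _) (fun n => norm_add_le (x n) (y n)) ?_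
    simpa using Filter.Tendsto.add hx hy
  smul_mem' c x hx := by
    refine squeeze_zero (fun n => norm_nonneg _) (fun n => norm_smul_le c (x n)) ?_
    simpa using Filter.Tendsto.const_mul ‖c‖ hx
  mul_mem_left' r x hx := by
    refine squeeze_zero (fun n => norm_nonneg _) (fun n => (norm_mul_le (r n) (x n)).trans
      (mul_le_mul_of_nonneg_right (lp.norm_apply_le_norm ENNReal.top_ne_zero r n)
        (norm_nonneg _))) ?_
    simpa using Filter.Tendsto.const_mul ‖r‖ hx
  mul_mem_right' r x hx := by
    refine squeeze_zero (fun n => norm_nonneg _) (fun n => (norm_mul_le (x n) (r n)).trans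
      (mul_le_mul_of_nonneg_left (lp.norm_apply_le_norm ENNReal.top_ne_zero r n)
        (norm_nonneg _))) ?_
    simpa using Filter.Tendsto.mul_const ‖r‖ hx
  star_mem' {x} hx := by
    have h : (fun n => ‖(star x : lp (fun _ : ℕ => A) ∞) n‖) = fun n => ‖x n‖ :=
      funext fun n => norm_star (x n)
    change Filter.Tendsto (fun n => ‖(star x : lp (fun _ : ℕ => A) ∞) n‖) _ _
    rw [h]
    exact hx

/-- `A^∞ = ℓ^∞(ℕ, A) / c₀(A)`. -/
abbrev SeqAlg (A : Type*) [NonUnitalCStarAlgebra A] : Type _ := (c0 A).Quot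

/-- Entrywise application of a homomorphism, `ℓ^∞(ℕ, A) → ℓ^∞(ℕ, B)`. -/
def lpMap (φ : A →⋆ₙₐ[ℂ] B) :
    lp (fun _ : ℕ => A) ∞ →⋆ₙₐ[ℂ] lp (fun _ : ℕ => B) ∞ where
  toFun x := ⟨fun n => φ (x n), by
    refine memℓp_infty ⟨‖x‖, ?_⟩
    rintro _ ⟨n, rfl⟩
    exact (NonUnitalStarAlgHom.norm_apply_le φ (x n)).trans
      (lp.norm_apply_le_norm ENNReal.top_ne_zero x n)⟩
  map_smul' c x := Subtype.ext (funext fun n => map_smul φ c (x n))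
  map_zero' := Subtype.ext (funext fun _ => map_zero φ)
  map_add' x y := Subtype.ext (funext fun n => map_add φ (x n) (y n))
  map_mul' x y := Subtype.ext (funext fun n => map_mul φ (x n) (y n))
  map_star' x := Subtype.ext (funext fun n => map_star φ (x n))

/-- The homomorphism `A^∞ → B^∞` induced by a homomorphism `A → B`. -/
def SeqAlg.map (φ : A →⋆ₙₐ[ℂ] B) : SeqAlg A →⋆ₙₐ[ℂ] SeqAlg B :=
  StarIdeal.Quot.map (lpMap φ) fun x hx =>
    squeeze_zero (fun _ => norm_nonneg _)
      (fun n => NonUnitalStarAlgHom.norm_apply_le φ (x n)) hx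

/-- The constant sequence with value `a`, as a bounded sequence. -/
def constSeq (a : A) : lp (fun _ : ℕ => A) ∞ :=
  ⟨fun _ => a, memℓp_infty ⟨‖a‖, by rintro _ ⟨n, rfl⟩; exact le_rfl⟩⟩

/-- The identification of `A` with the constant sequences in `A^∞`. -/
def ι (a : A) : SeqAlg A := (c0 A).proj (constSeq a)

theorem ι_star (a : A) : ι (star a) = star (ι a) := rfl

theorem SeqAlg.map_ι (φ : A →⋆ₙₐ[ℂ] B) (a : A) : SeqAlg.map φ (ι a) = ι (φ a) := rfl

/-- `A_∞ = A^∞ ∩ A'`, the algebra of central sequences. -/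
def CentralSeq (A : Type*) [NonUnitalCStarAlgebra A] : NonUnitalStarSubalgebra ℂ (SeqAlg A) :=
  NonUnitalStarSubalgebra.centralizer ℂ (Set.range (ι : A → SeqAlg A))

theorem mem_centralSeq_iff {x : SeqAlg A} :
    x ∈ CentralSeq A ↔ ∀ a : A, ι a * x = x * ι a := by
  rw [CentralSeq, NonUnitalStarSubalgebra.mem_centralizer_iff, Set.forall_mem_range]
  exact ⟨fun h a => (h a).1, fun h a => ⟨h a, by rw [← ι_star]; exact h (star a)⟩⟩

/-- `Ann(A, A^∞)`: the central sequences `x` with `x a = 0` for all `a ∈ A`. -/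
def Ann (A : Type*) [NonUnitalCStarAlgebra A] : StarIdeal (CentralSeq A) where
  carrier := {x | ∀ a : A, (x : SeqAlg A) * ι a = 0}
  zero_mem' a := zero_mul _
  add_mem' {x y} hx hy a := by
    change ((x : SeqAlg A) + (y : SeqAlg A)) * ι a = 0
    rw [add_mul, hx a, hy a, add_zero]
  smul_mem' c x hx a := by
    change (c • (x : SeqAlg A)) * ι a = 0
    rw [smul_mul_assoc, hx a, smul_zero]
  mul_mem_left' r x hx a := by
    change ((r : SeqAlg A) * (x : SeqAlg A)) * ι a = 0
    rw [mul_assoc, hx a, mul_zero]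
  mul_mem_right' r x hx a := by
    change ((x : SeqAlg A) * (r : SeqAlg A)) * ι a = 0
    rw [mul_assoc, ← mem_centralSeq_iff.1 r.2 a, ← mul_assoc, hx a, zero_mul]
  star_mem' {x} hx a := by
    change star (x : SeqAlg A) * ι a = 0
    rw [← star_star (ι a), ← ι_star, ← star_mul, mem_centralSeq_iff.1 x.2, hx, star_zero]

/-- Kirchberg's central sequence algebra `F(A) = A_∞ / Ann(A, A^∞)`. -/
abbrev F (A : Type*) [NonUnitalCStarAlgebra A] : Type _ := (Ann A).Quot

/-- The isomorphism `φ : A ≃ B` induces a homomorphism `A_∞ → B_∞`. -/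
def CentralSeq.map (φ : A ≃⋆ₐ[ℂ] B) : CentralSeq A →⋆ₙₐ[ℂ] CentralSeq B :=
  NonUnitalStarAlgHom.codRestrict
    ((SeqAlg.map (φ : A →⋆ₙₐ[ℂ] B)).comp (NonUnitalStarSubalgebraClass.subtype (CentralSeq A)))
    (CentralSeq B) fun x => mem_centralSeq_iff.2 fun b => by
      obtain ⟨a, rfl⟩ := φ.surjective b
      have h := congrArg (SeqAlg.map (φ : A →⋆ₙₐ[ℂ] B)) (mem_centralSeq_iff.1 x.2 a)
      rw [map_mul, map_mul, SeqAlg.map_ι] at h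
      exact h

/-- The homomorphism `F(A) → F(B)` induced by an isomorphism `A ≃ B`. -/
def F.map (φ : A ≃⋆ₐ[ℂ] B) : F A →⋆ₙₐ[ℂ] F B :=
  StarIdeal.Quot.map (CentralSeq.map φ) fun x hx b => by
    obtain ⟨a, rfl⟩ := φ.surjective b
    have h := congrArg (SeqAlg.map (φ : A →⋆ₙₐ[ℂ] B)) (hx a)
    rw [map_mul, map_zero, SeqAlg.map_ι] at h
    exact h

end Sequences

/-! ### Units, unitary representations, σ-unitality -/

/-- `e` is the unit of the (a priori non-unital) ring `R`. -/
def IsUnitElement {R : Type*} [Mul R] (e : R) : Prop := ∀ x : R, e * x = x ∧ x * e = x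

/-- `u` is a unitary representation of `G` on `R`, i.e. a homomorphism from `G` to the unitary
group of `R`. This includes that `R` has a unit. -/
structure IsUnitaryRep {G R : Type*} [Group G] [Mul R] [Star R] (u : G → R) : Prop where
  map_one : IsUnitElement (u 1)
  map_mul : ∀ g h, u (g * h) = u g * u h
  star_mul_self : ∀ g, IsUnitElement (star (u g) * u g)
  mul_star_self : ∀ g, IsUnitElement (u g * star (u g))

/-- `A` is σ-unital: it has a countable approximate unit, that is, a sequence of positive
contractions `h n` with `h n * a → a` and `a * h n → a` for every `a`. -/
def IsSigmaUnital (A : Type*) [NonUnitalCStarAlgebra A] [PartialOrder A] [StarOrderedRing A] :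
    Prop :=
  ∃ h : ℕ → A, (∀ n, 0 ≤ h n ∧ ‖h n‖ ≤ 1) ∧
    ∀ a : A, Filter.Tendsto (fun n => h n * a) Filter.atTop (nhds a) ∧
      Filter.Tendsto (fun n => a * h n) Filter.atTop (nhds a)

/-! ### Fixed point algebras, the Rohlin property and approximate representability -/

section Actions

variable {G A : Type*} [NonUnitalCStarAlgebra A]

theorem continuous_aut (φ : A ≃⋆ₐ[ℂ] A) : Continuous φ :=
  AddMonoidHomClass.continuous_of_bound φ 1 fun a => by
    rw [one_mul]; exact NonUnitalStarAlgHom.norm_apply_le φ a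

/-- The fixed point algebra `A^α`. -/
def fixedPoints [Group G] (α : G →* (A ≃⋆ₐ[ℂ] A)) : NonUnitalStarSubalgebra ℂ A where
  carrier := {a | ∀ g, α g a = a}
  zero_mem' g := map_zero _
  add_mem' ha hb g := by rw [map_add, ha g, hb g]
  mul_mem' ha hb g := by rw [map_mul, ha g, hb g]
  smul_mem' c a ha g := by rw [map_smul, ha g]
  star_mem' ha g := by rw [map_star, ha g]

instance isClosed_fixedPoints [Group G] (α : G →* (A ≃⋆ₐ[ℂ] A)) :
    IsClosed (fixedPoints α : Set A) := by
  have h : (fixedPoints α : Set A) = ⋂ g, {a | α g a = a} := by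
    ext a; rw [Set.mem_iInter]; rfl
  rw [h]
  exact isClosed_iInter fun g => isClosed_eq (continuous_aut (α g)) continuous_id

/-- The Rohlin property: there is a partition of unity `(e g)` in `F(A)` consisting of
projections (mutually orthogonal, with sum the unit of `F(A)`) such that `α_g(e_h) = e_{gh}`. -/
def HasRohlinProperty [Group G] [Fintype G] (α : G →* (A ≃⋆ₐ[ℂ] A)) : Prop :=
  ∃ e : G → F A, (∀ g, IsStarProjection (e g)) ∧
    (∀ g h, g ≠ h → e g * e h = 0) ∧
    IsUnitElement (∑ g, e g) ∧
    ∀ g h, F.map (α g) (e h) = e (g * h)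

/-- The homomorphism `(A^α)^∞ → A^∞` induced by the inclusion. -/
def fixedPointsIncl [Group G] (α : G →* (A ≃⋆ₐ[ℂ] A)) :
    SeqAlg (fixedPoints α) →⋆ₙₐ[ℂ] SeqAlg A :=
  SeqAlg.map (NonUnitalStarSubalgebraClass.subtype (fixedPoints α))

/-- Approximate representability: there are `w(g) ∈ (A^α)_∞` whose classes form a unitary
representation of `G` on `F(A^α)`, and `α_g(a) = w(g) a w(g)*` in `A^∞`. -/
def IsApproximatelyRepresentable [CommGroup G] (α : G →* (A ≃⋆ₐ[ℂ] A)) : Prop :=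
  ∃ w : G → CentralSeq (fixedPoints α),
    IsUnitaryRep (fun g => (Ann (fixedPoints α)).proj (w g)) ∧
    ∀ g (a : A), ι (α g a) =
      fixedPointsIncl α (w g : SeqAlg (fixedPoints α)) * ι a *
        star (fixedPointsIncl α (w g : SeqAlg (fixedPoints α)))

end Actions

/-! ### The crossed product and the dual action -/

section CrossedProduct

variable {G A : Type*} [NonUnitalCStarAlgebra A]

section Group

variable [Group G]

/-- The operator `∑ g, f g λ_g` in the regular representation on the Hilbert module `ℓ²(G, A)`,
where `(a ξ)(h) = α_{h⁻¹}(a) ξ(h)` and `(λ_g ξ)(h) = ξ(g⁻¹ h)`, written as a matrix. -/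
def regular (α : G →* (A ≃⋆ₐ[ℂ] A)) (f : G → A) : CStarMatrix G G A :=
  CStarMatrix.ofMatrix fun h k => α h⁻¹ (f (h * k⁻¹))

theorem regular_apply (α : G →* (A ≃⋆ₐ[ℂ] A)) (f : G → A) (h k : G) :
    regular α f h k = α h⁻¹ (f (h * k⁻¹)) := rfl

theorem mem_range_regular_iff (α : G →* (A ≃⋆ₐ[ℂ] A)) (M : CStarMatrix G G A) :
    M ∈ Set.range (regular α) ↔ ∀ g h k, M (h * g) (k * g) = α g⁻¹ (M h k) := by
  constructor
  · rintro ⟨f, rfl⟩ g h k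
    rw [regular_apply, regular_apply, ← StarAlgEquiv.mul_apply, ← map_mul]
    congr 2 <;> group
  · intro hM
    refine ⟨fun s => α s (M s 1), CStarMatrix.ext fun h k => ?_⟩
    rw [regular_apply, ← StarAlgEquiv.mul_apply, ← map_mul, inv_mul_cancel_left, ← hM k,
      inv_mul_cancel_right, one_mul]

/-- Multiplication in the crossed product: `(a λ_g) (b λ_h) = a α_g(b) λ_{gh}`. -/
theorem regular_mul [Fintype G] (α : G →* (A ≃⋆ₐ[ℂ] A)) (f f' : G → A) :
    regular α f * regular α f' = regular α fun g => ∑ s, f s * α s (f' (s⁻¹ * g)) := by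
  refine CStarMatrix.ext fun h k => ?_
  rw [CStarMatrix.mul_apply, regular_apply, map_sum]
  refine Fintype.sum_equiv ((Equiv.inv G).trans (Equiv.mulLeft h)) _ _ fun l => ?_
  simp only [regular_apply, Equiv.trans_apply, Equiv.inv_apply, Equiv.coe_mulLeft]
  rw [map_mul (α h⁻¹), ← StarAlgEquiv.mul_apply, ← map_mul α]
  congr 3 <;> group

theorem star_regular (α : G →* (A ≃⋆ₐ[ℂ] A)) (f : G → A) :
    star (regular α f) = regular α fun g => α g (star (f g⁻¹)) := by
  refine CStarMatrix.ext fun h k => ?_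
  rw [CStarMatrix.star_apply, regular_apply, regular_apply, ← StarAlgEquiv.mul_apply, ← map_mul,
    ← map_star]
  congr 2 <;> group

variable [Fintype G]

/-- The (reduced) crossed product `A ⋊_α G` by a finite group: the star-algebra of all
`∑ g, f g λ_g` acting on `ℓ²(G, A)`. -/
def crossedProduct (α : G →* (A ≃⋆ₐ[ℂ] A)) : NonUnitalStarSubalgebra ℂ (CStarMatrix G G A) where
  carrier := Set.range (regular α)
  zero_mem' := ⟨0, CStarMatrix.ext fun h k => by simp [regular_apply]⟩
  add_mem' := by
    rintro _ _ ⟨f, rfl⟩ ⟨f', rfl⟩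
    exact ⟨f + f', CStarMatrix.ext fun h k => by simp [regular_apply]⟩
  mul_mem' := by
    rintro _ _ ⟨f, rfl⟩ ⟨f', rfl⟩
    exact ⟨_, (regular_mul α f f').symm⟩
  smul_mem' := by
    rintro c _ ⟨f, rfl⟩
    exact ⟨c • f, CStarMatrix.ext fun h k => by simp [regular_apply]⟩
  star_mem' := by
    rintro _ ⟨f, rfl⟩
    exact ⟨_, (star_regular α f).symm⟩

instance isClosed_crossedProduct [PartialOrder A] [StarOrderedRing A]
    (α : G →* (A ≃⋆ₐ[ℂ] A)) :
    IsClosed (crossedProduct α : Set (CStarMatrix G G A)) := by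
  have hc (h k : G) : Continuous fun M : CStarMatrix G G A => M h k :=
    (continuous_apply k).comp (continuous_apply (A := fun _ : G => G → A) h)
  have hs : (crossedProduct α : Set (CStarMatrix G G A)) =
      ⋂ (g : G) (h : G) (k : G), {M | M (h * g) (k * g) = α g⁻¹ (M h k)} := by
    ext M
    simp only [Set.mem_iInter]
    exact mem_range_regular_iff α M
  rw [hs]
  exact isClosed_iInter fun g => isClosed_iInter fun h => isClosed_iInter fun k =>
    isClosed_eq (hc _ _) ((continuous_aut _).comp (hc _ _))

end Group

section Dual

variable [CommGroup G]

instance finite_dual [Finite G] : Finite (G →* Circle) := by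
  have hinj : Function.Injective
      fun γ : G →* Circle => (Circle.toUnits.comp γ : G →* ℂˣ) := fun γ γ' h =>
    MonoidHom.ext fun g => Circle.ext (congrArg Units.val (DFunLike.congr_fun h g))
  exact Finite.of_injective _ hinj

/-- The dual group of a finite abelian group is finite. -/
instance fintypeDual [Finite G] : Fintype (G →* Circle) := Fintype.ofFinite _

variable [Fintype G]

/-- `f ↦ γ f`, that is `∑ g, f g λ_g ↦ ∑ g, γ(g) f g λ_g`, on the crossed product. -/
def dualMap (α : G →* (A ≃⋆ₐ[ℂ] A)) (γ : G →* Circle) (M : crossedProduct α) :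
    crossedProduct α :=
  ⟨CStarMatrix.ofMatrix fun h k => (γ (h * k⁻¹) : ℂ) • (M : CStarMatrix G G A) h k, by
    obtain ⟨f, hf⟩ := M.2
    refine ⟨fun g => (γ g : ℂ) • f g, CStarMatrix.ext fun h k => ?_⟩
    rw [← hf, regular_apply, map_smul]
    rfl⟩

theorem dualMap_apply (α : G →* (A ≃⋆ₐ[ℂ] A)) (γ : G →* Circle) (M : crossedProduct α) (h k : G) :
    (dualMap α γ M : CStarMatrix G G A) h k =
      (γ (h * k⁻¹) : ℂ) • (M : CStarMatrix G G A) h k := rfl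

theorem dualMap_regular (α : G →* (A ≃⋆ₐ[ℂ] A)) (γ : G →* Circle) (f : G → A) :
    (dualMap α γ ⟨regular α f, f, rfl⟩ : CStarMatrix G G A) =
      regular α fun g => (γ g : ℂ) • f g :=
  CStarMatrix.ext fun h _ => (map_smul (α h⁻¹) _ _).symm

theorem dualMap_dualMap (α : G →* (A ≃⋆ₐ[ℂ] A)) (γ γ' : G →* Circle) (M : crossedProduct α) :
    dualMap α γ (dualMap α γ' M) = dualMap α (γ * γ') M :=
  Subtype.ext <| CStarMatrix.ext fun h k => by
    simp only [dualMap_apply, MonoidHom.mul_apply, Circle.coe_mul, mul_smul]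

theorem dualMap_one (α : G →* (A ≃⋆ₐ[ℂ] A)) (M : crossedProduct α) : dualMap α 1 M = M :=
  Subtype.ext <| CStarMatrix.ext fun h k => by simp [dualMap_apply]

/-- The automorphism `a λ_g ↦ γ(g) a λ_g` of the crossed product. -/
def dualAut (α : G →* (A ≃⋆ₐ[ℂ] A)) (γ : G →* Circle) :
    crossedProduct α ≃⋆ₐ[ℂ] crossedProduct α where
  toFun := dualMap α γ
  invFun := dualMap α γ⁻¹
  left_inv M := by rw [dualMap_dualMap, inv_mul_cancel, dualMap_one]
  right_inv M := by rw [dualMap_dualMap, mul_inv_cancel, dualMap_one]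
  map_mul' M N := Subtype.ext <| CStarMatrix.ext fun h k => by
    change (γ (h * k⁻¹) : ℂ) • ((M : CStarMatrix G G A) * (N : CStarMatrix G G A)) h k =
      ((dualMap α γ M : CStarMatrix G G A) * (dualMap α γ N : CStarMatrix G G A)) h k
    rw [CStarMatrix.mul_apply, CStarMatrix.mul_apply, Finset.smul_sum]
    refine Finset.sum_congr rfl fun l _ => ?_
    rw [dualMap_apply, dualMap_apply, smul_mul_smul_comm, ← Circle.coe_mul, ← map_mul]
    congr 3
    group
  map_add' M N := Subtype.ext <| CStarMatrix.ext fun h k => smul_add _ _ _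
  map_star' M := Subtype.ext <| CStarMatrix.ext fun h k => by
    change (γ (h * k⁻¹) : ℂ) • (star (M : CStarMatrix G G A)) h k =
      (star (dualMap α γ M : CStarMatrix G G A)) h k
    rw [CStarMatrix.star_apply, CStarMatrix.star_apply, dualMap_apply, star_smul]
    congr 1
    have hi : γ (h * k⁻¹) = (γ (k * h⁻¹))⁻¹ := by rw [← map_inv]; congr 1; group
    rw [hi, Circle.coe_inv_eq_conj]; rfl
  map_smul' c M := Subtype.ext <| CStarMatrix.ext fun h k => smul_comm _ _ _

/-- The dual action `α̂` of the dual group of `G` on `A ⋊_α G`. -/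
def dualAction (α : G →* (A ≃⋆ₐ[ℂ] A)) :
    (G →* Circle) →* (crossedProduct α ≃⋆ₐ[ℂ] crossedProduct α) where
  toFun := dualAut α
  map_one' := StarAlgEquiv.ext (dualMap_one α)
  map_mul' γ γ' := StarAlgEquiv.ext fun M => (dualMap_dualMap α γ γ' M).symm

end Dual

end CrossedProduct

end RohlinDuality

end

noncomputable section

namespace RohlinDuality

/-! The Fourier transform turns both statements into statements about unitary eigenvectors. A
partition of unity in `F(B)` permuted by a finite abelian group is the same as a unitary
representation of the dual group in `F(B)` by eigenvectors of the action
(`exists_partition_iff_exists_eigenRep`). Approximate representability is also about a unitary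
representation, so on each side a representation has to be matched with one in another algebra.

For (i), the fixed point algebra of the dual action is a copy of `A`, so both conditions concern
elements x_γ of `A^∞`, γ in the dual group. Since x (a λ_g) x* = x a α_g(x)* λ_g, the x_γ implement
the dual action exactly when α_g(x_γ) is the conjugate of γ(g) times x_γ modulo the annihilator
(`eigen_iff_conj`, `dualAction_eq_conj_iff`).

For (ii), if w(g) is fixed by α and implements α_g, then w(g)* λ_g commutes with the crossed product
and is an eigenvector of the dual action (`actsAsRep_seqMonomial_star`). Conversely, a central
eigenvector agrees modulo the annihilator with its spectral component v_g λ_g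
(`actsAsRep_seqMonomial_seqCoeff`). Centrality makes v_g invariant under α modulo the annihilator
and gives v_g* a v_g = α_g(a), so the average of v_g* over `G` is the required w(g).

Identities in `F(B)` hold only after multiplication by elements of `B`, and `ActsAsRep` records them
in that form. σ-unitality supplies an approximate unit, which identifies the unit of `F(B)`; its
average over `G` lies in the fixed point algebra and is still an approximate unit of `A`, so
relations tested on the fixed point algebra extend to `A`. -/

/-! ### Pairings of finite abelian groups -/

section Pairing

/-- A perfect pairing of two finite abelian groups with values in the circle. -/
structure IsPerfectPairing {G K : Type*} [CommGroup G] [Fintype G] [CommGroup K] [Fintype K]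
    (p : G →* K →* Circle) : Prop where
  card_eq : Fintype.card G = Fintype.card K
  exists_right : ∀ g, g ≠ 1 → ∃ k, p g k ≠ 1
  exists_left : ∀ k, k ≠ 1 → ∃ g, p g k ≠ 1

theorem sum_circleHom_eq_zero {H : Type*} [Group H] [Fintype H] (χ : H →* Circle)
    (hχ : ∃ h, χ h ≠ 1) : ∑ h, (χ h : ℂ) = 0 := by
  obtain ⟨h, hh⟩ := hχ
  refine sum_hom_units_eq_zero (Circle.coeHom.comp χ) fun h1 => hh ?_
  exact Circle.ext (DFunLike.congr_fun h1 h)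

theorem card_circleHom (G : Type*) [CommGroup G] [Fintype G] :
    Fintype.card (G →* Circle) = Fintype.card G := by
  have e : AddChar (Additive G) ℂ ≃ (G →* Circle) :=
    AddChar.circleEquivComplex.symm.toEquiv.trans AddChar.toMonoidHomEquiv
  rw [← Fintype.card_congr e, AddChar.card_eq]
  exact Fintype.card_congr Additive.toMul

theorem exists_circleHom_ne_one {G : Type*} [CommGroup G] [Finite G] {g : G} (hg : g ≠ 1) :
    ∃ γ : G →* Circle, γ g ≠ 1 := by
  obtain ⟨ψ, hψ⟩ := (AddChar.exists_apply_ne_zero (a := Additive.ofMul g)).2 (by simpa using hg)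
  refine ⟨AddChar.toMonoidHomEquiv (AddChar.circleEquivComplex.symm ψ), fun h => hψ ?_⟩
  have h2 : (AddChar.circleEquivComplex (AddChar.circleEquivComplex.symm ψ)) (Additive.ofMul g) =
      ((AddChar.toMonoidHomEquiv (AddChar.circleEquivComplex.symm ψ) :
        G →* Circle) g : ℂ) := rfl
  rw [AddEquiv.apply_symm_apply] at h2
  exact h2.trans (congrArg ((↑) : Circle → ℂ) h)

variable {G : Type*} [CommGroup G] [Fintype G]

theorem isPerfectPairing_id :
    IsPerfectPairing (MonoidHom.id (G →* Circle)) where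
  card_eq := card_circleHom G
  exists_right γ hγ := by
    by_contra! h
    exact hγ (MonoidHom.ext h)
  exists_left _ hg := exists_circleHom_ne_one hg

/-- The inverse is needed because conjugation by x_γ multiplies the coefficient of λ_g by the
conjugate of the α_g-eigenvalue of x_γ; for the result to be γ(g), the eigenvalue must be γ(g)⁻¹. -/
theorem isPerfectPairing_eval_inv :
    IsPerfectPairing (MonoidHom.eval⁻¹ : G →* (G →* Circle) →* Circle) where
  card_eq := (card_circleHom G).symm
  exists_right g hg := by
    obtain ⟨γ, hγ⟩ := exists_circleHom_ne_one hg
    exact ⟨γ, by simpa using hγ⟩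
  exists_left γ hγ := by
    by_contra! h
    exact hγ (MonoidHom.ext fun g => by simpa using h g)

end Pairing

/-! ### Partitions of unity and unitary representations -/

section PartitionOfUnity

theorem IsUnitaryRep.star_eq {R K : Type*} [NonUnitalRing R] [StarRing R] [Group K]
    {u : K → R} (hu : IsUnitaryRep u) (k : K) :
    star (u k) = u k⁻¹ := by
  calc star (u k) = star (u k) * u 1 := ((hu.map_one _).2).symm
    _ = star (u k) * u k * u k⁻¹ := by rw [mul_assoc, ← hu.map_mul, mul_inv_cancel]
    _ = u k⁻¹ := ((hu.star_mul_self k) _).1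

variable {R : Type*} [NonUnitalRing R] [StarRing R] [Module ℂ R]
  {G K : Type*} [CommGroup G] [Fintype G] [CommGroup K] [Fintype K]
  [IsScalarTower ℂ R R] [SMulCommClass ℂ R R] [StarModule ℂ R]

/-- Fourier transform: partitions of unity permuted by an action of `G` correspond to unitary
representations of the dual group consisting of eigenvectors. -/
theorem exists_partition_iff_exists_eigenRep {p : G →* K →* Circle} (hp : IsPerfectPairing p)
    (φ : G → R →⋆ₙₐ[ℂ] R) :
    (∃ e : G → R, (∀ g, IsStarProjection (e g)) ∧ (∀ g h, g ≠ h → e g * e h = 0) ∧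
      IsUnitElement (∑ g, e g) ∧ ∀ g h, φ g (e h) = e (g * h)) ↔
    ∃ u : K → R, IsUnitaryRep u ∧ ∀ g k, φ g (u k) = (p g k : ℂ) • u k := by
  classical
  constructor
  · rintro ⟨e, he, ho, h1, hφ⟩
    have hmul (c d : G → ℂ) : (∑ g, c g • e g) * (∑ g, d g • e g) = ∑ g, (c g * d g) • e g := by
      rw [Finset.sum_mul_sum]
      refine Finset.sum_congr rfl fun g _ => ?_
      rw [Finset.sum_eq_single g]
      · rw [smul_mul_smul_comm, (he g).isIdempotentElem]
      · intro h _ hgh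
        rw [smul_mul_smul_comm, ho g h hgh.symm, smul_zero]
      · simp
    have hstar (c : G → ℂ) : star (∑ g, c g • e g) = ∑ g, star (c g) • e g := by
      rw [star_sum]
      exact Finset.sum_congr rfl fun g _ => by rw [star_smul, (he g).isSelfAdjoint.star_eq]
    have hone {c : G → ℂ} (hc : ∀ g, c g = 1) : IsUnitElement (∑ g, c g • e g) := by
      simpa [hc] using h1
    -- With inverse characters as coefficients, the shift of e h to e (g * h) pulls out the factor p
    -- g k, not its inverse.
    refine ⟨fun k => ∑ g, ((p g k)⁻¹ : Circle) • e g, ⟨?_, ?_, ?_, ?_⟩, ?_⟩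
    · exact hone (c := fun g => (((p g 1)⁻¹ : Circle) : ℂ)) fun g => by simp
    · intro k l
      refine Eq.trans ?_ (hmul (fun g => (((p g k)⁻¹ : Circle) : ℂ)) _).symm
      refine Finset.sum_congr rfl fun g _ => ?_
      rw [← Circle.coe_mul, ← mul_inv, ← map_mul, Circle.smul_def]
    · intro k
      have h := hmul (fun g => star (((p g k)⁻¹ : Circle) : ℂ)) fun g => (((p g k)⁻¹ : Circle) : ℂ)
      rw [← hstar] at h
      change IsUnitElement (star (∑ g, (((p g k)⁻¹ : Circle) : ℂ) • e g) * _)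
      refine (congrArg IsUnitElement h).mpr (hone fun g => ?_)
      rw [Complex.star_def, ← Circle.coe_inv_eq_conj, ← Circle.coe_mul]
      simp
    · intro k
      have h := hmul (fun g => (((p g k)⁻¹ : Circle) : ℂ)) fun g => star (((p g k)⁻¹ : Circle) : ℂ)
      rw [← hstar] at h
      refine (congrArg IsUnitElement h).mpr (hone fun g => ?_)
      rw [Complex.star_def, ← Circle.coe_inv_eq_conj, ← Circle.coe_mul]
      simp
    · intro g k
      simp only [Circle.smul_def]
      rw [map_sum, Finset.smul_sum]
      refine Fintype.sum_equiv (Equiv.mulLeft g) _ _ fun h => ?_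
      rw [map_smul, hφ, smul_smul, Equiv.coe_mulLeft, map_mul, MonoidHom.mul_apply, mul_inv,
        ← Circle.coe_mul, mul_inv_cancel_left]
  · rintro ⟨u, hu, hφ⟩
    set n : ℂ := (Fintype.card K : ℂ)
    have hn : n ≠ 0 := Nat.cast_ne_zero.2 Fintype.card_ne_zero
    have hinv (g : G) (k : K) : star (p g k : ℂ) = p g k⁻¹ := by
      rw [Complex.star_def, ← Circle.coe_inv_eq_conj, map_inv]
    -- Inverse Fourier transform.
    set e : G → R := fun g => n⁻¹ • ∑ k, (p g k : ℂ) • u k with he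
    -- Reindexing gives u k * e h = (p h k)⁻¹ • e h, so e g * e h is a character sum times e h.
    -- Orthogonality and idempotence both follow from the value of that sum.
    have hmul (g h : G) : e g * e h = (n⁻¹ * ∑ k, (p (g * h⁻¹) k : ℂ)) • e h := by
      simp only [he]
      rw [smul_mul_smul_comm, Finset.sum_mul_sum, smul_smul, mul_right_comm,
        mul_smul _ (Finset.sum _ _), Finset.sum_smul]
      congr 1
      refine Finset.sum_congr rfl fun k _ => ?_
      rw [Finset.smul_sum]
      refine Fintype.sum_equiv (Equiv.mulLeft k) _ _ fun l => ?_
      rw [smul_mul_smul_comm, ← hu.map_mul, Equiv.coe_mulLeft, smul_smul]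
      congr 1
      rw [← Circle.coe_mul, ← Circle.coe_mul]
      congr 1
      simp only [map_mul, MonoidHom.mul_apply, map_inv, MonoidHom.inv_apply]
      rw [mul_assoc, inv_mul_cancel_left]
    refine ⟨e, fun g => ⟨?_, ?_⟩, ?_, ?_, ?_⟩
    · change e g * e g = e g
      rw [hmul]
      simp [n]
    · change star (e g) = e g
      simp only [he]
      rw [star_smul, star_sum]
      congr 1
      · simp [n]
      · refine Fintype.sum_equiv (Equiv.inv K) _ _ fun k => ?_
        rw [star_smul, hu.star_eq, hinv, Equiv.inv_apply]
    · intro g h hgh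
      rw [hmul, sum_circleHom_eq_zero _ (hp.exists_right _ (by rwa [Ne, mul_inv_eq_one])), mul_zero,
        zero_smul]
    -- Summing over g kills every k ≠ 1 by nondegeneracy; the remaining factor |G|/|K| is 1.
    · have : ∑ g, e g = u 1 := by
        simp only [he]
        rw [← Finset.smul_sum, Finset.sum_comm, Finset.sum_eq_single 1]
        · simp only [map_one, Circle.coe_one, one_smul, Finset.sum_const, Finset.card_univ]
          rw [hp.card_eq, ← Nat.cast_smul_eq_nsmul ℂ, smul_smul, inv_mul_cancel₀ hn, one_smul]
        · intro k _ hk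
          rw [← Finset.sum_smul]
          have := sum_circleHom_eq_zero (p.flip k) (hp.exists_left k hk)
          simp only [MonoidHom.flip_apply] at this
          rw [this, zero_smul]
        · simp
      rw [this]
      exact hu.map_one
    · intro g h
      simp only [he]
      rw [map_smul, map_sum]
      congr 1
      refine Finset.sum_congr rfl fun k _ => ?_
      rw [map_smul, hφ, smul_smul, map_mul, MonoidHom.mul_apply, Circle.coe_mul, mul_comm]

end PartitionOfUnity

/-- The Rohlin property in terms of unitary eigenvectors in `F(A)`. -/
theorem hasRohlinProperty_iff {A G K : Type*} [NonUnitalCStarAlgebra A] [CommGroup G] [Fintype G]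
    [CommGroup K] [Fintype K] {p : G →* K →* Circle} (hp : IsPerfectPairing p)
    (α : G →* (A ≃⋆ₐ[ℂ] A)) :
    HasRohlinProperty α ↔
      ∃ u : K → F A, IsUnitaryRep u ∧ ∀ g k, F.map (α g) (u k) = (p g k : ℂ) • u k :=
  exists_partition_iff_exists_eigenRep hp fun g => F.map (α g)

/-! ### Calculus in sequence algebras -/

section SequenceAlgebra

variable {A B C : Type*} [NonUnitalCStarAlgebra A] [NonUnitalCStarAlgebra B]
  [NonUnitalCStarAlgebra C]

theorem proj_c0_eq_zero_iff (X : lp (fun _ : ℕ => A) ∞) :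
    (c0 A).proj X = 0 ↔ Filter.Tendsto (fun n => ‖X n‖) Filter.atTop (nhds 0) := by
  rw [← map_zero (c0 A).proj, (c0 A).proj_eq_iff, sub_zero]
  rfl

theorem ι_mul (a b : A) : ι (a * b) = ι a * ι b := rfl

theorem ι_add (a b : A) : ι (a + b) = ι a + ι b := rfl

theorem ι_smul (c : ℂ) (a : A) : ι (c • a) = c • ι a := rfl

theorem ι_sum {I : Type*} (s : Finset I) (f : I → A) : ι (∑ i ∈ s, f i) = ∑ i ∈ s, ι (f i) :=
  map_sum (AddMonoidHom.mk' ι ι_add) f s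

/-- Entrywise application of a bounded linear map to a bounded sequence. -/
def lpMapL (T : A →L[ℂ] B) : lp (fun _ : ℕ => A) ∞ →ₗ[ℂ] lp (fun _ : ℕ => B) ∞ where
  toFun x := ⟨fun n => T (x n), by
    refine memℓp_infty ⟨‖T‖ * ‖x‖, ?_⟩
    rintro _ ⟨n, rfl⟩
    exact T.le_opNorm_of_le (lp.norm_apply_le_norm ENNReal.top_ne_zero x n)⟩
  map_smul' c x := Subtype.ext (funext fun n => map_smul T c (x n))
  map_add' x y := Subtype.ext (funext fun n => map_add T (x n) (y n))

/-- The linear map `A^∞ → B^∞` induced by a bounded linear map `A → B`. -/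
def SeqAlg.mapL (T : A →L[ℂ] B) : SeqAlg A →ₗ[ℂ] SeqAlg B :=
  (c0 A).toSubmodule.mapQ (c0 B).toSubmodule (lpMapL T) fun x hx => by
    refine squeeze_zero (fun _ => norm_nonneg _) (fun n => T.le_opNorm (x n)) ?_
    simpa using Filter.Tendsto.const_mul ‖T‖ hx

theorem SeqAlg.map_proj (φ : A →⋆ₙₐ[ℂ] B) (X : lp (fun _ : ℕ => A) ∞) :
    SeqAlg.map φ ((c0 A).proj X) = (c0 B).proj (lpMap φ X) := rfl

theorem SeqAlg.map_map (ψ : B →⋆ₙₐ[ℂ] C) (φ : A →⋆ₙₐ[ℂ] B) (x : SeqAlg A) :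
    SeqAlg.map ψ (SeqAlg.map φ x) = SeqAlg.map (ψ.comp φ) x := by
  obtain ⟨X, rfl⟩ := (c0 A).proj_surjective x
  rfl

theorem SeqAlg.map_of_forall_eq {φ : A →⋆ₙₐ[ℂ] A} (h : ∀ a, φ a = a) (x : SeqAlg A) :
    SeqAlg.map φ x = x := by
  obtain ⟨X, rfl⟩ := (c0 A).proj_surjective x
  exact congrArg (c0 A).proj (Subtype.ext (funext fun n => h (X n)))

/-- A representing sequence is bounded, so left multiplication by it is uniformly continuous in a.
This allows relations to be checked on a dense set. -/
theorem isClosed_mul_ι_eq_zero (x : SeqAlg A) : IsClosed {a : A | x * ι a = 0} := by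
  obtain ⟨X, rfl⟩ := (c0 A).proj_surjective x
  have key (a : A) : (c0 A).proj X * ι a = 0 ↔
      Filter.Tendsto (fun n => ‖X n * a‖) Filter.atTop (nhds 0) := by
    rw [ι, ← map_mul, proj_c0_eq_zero_iff]
    rfl
  refine isClosed_of_closure_subset fun a ha => ?_
  refine (key a).2 (Metric.tendsto_atTop.2 ?_)
  intro ε hε
  -- The 1 added to ‖X‖ keeps the denominator positive when X = 0.
  have hpos : 0 < ε / (2 * (‖X‖ + 1)) := by positivity
  obtain ⟨b, hb, hab⟩ := Metric.mem_closure_iff.1 ha _ hpos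
  obtain ⟨N, hN⟩ := Metric.tendsto_atTop.1 ((key b).1 hb) (ε / 2) (half_pos hε)
  refine ⟨N, fun n hn => ?_⟩
  have h1 := hN n hn
  rw [dist_zero_right, norm_norm] at h1 ⊢
  rw [dist_eq_norm] at hab
  have h2 : ‖X n * (a - b)‖ ≤ ε / 2 := by
    calc ‖X n * (a - b)‖ ≤ ‖X n‖ * ‖a - b‖ := norm_mul_le _ _
      _ ≤ (‖X‖ + 1) * (ε / (2 * (‖X‖ + 1))) := by
        gcongr
        exact (lp.norm_apply_le_norm ENNReal.top_ne_zero X n).trans (by linarith)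
      _ = ε / 2 := by field_simp
  calc ‖X n * a‖ = ‖X n * (a - b) + X n * b‖ := by rw [← mul_add, sub_add_cancel]
    _ ≤ ‖X n * (a - b)‖ + ‖X n * b‖ := norm_add_le _ _
    _ < ε := by linarith

/-- `e ∈ A^∞` is the class of an approximate unit of `A`. -/
def IsSeqUnit (e : SeqAlg A) : Prop := ∀ a : A, e * ι a = ι a ∧ ι a * e = ι a

theorem IsSeqUnit.mem_centralSeq {e : SeqAlg A} (he : IsSeqUnit e) : e ∈ CentralSeq A :=
  mem_centralSeq_iff.2 fun a => (he a).2.trans (he a).1.symm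

theorem mul_ι_eq_of_tendsto {X : lp (fun _ : ℕ => A) ∞} {a b : A}
    (h : Filter.Tendsto (fun n => X n * a) Filter.atTop (nhds b)) :
    (c0 A).proj X * ι a = ι b := by
  rw [← sub_eq_zero, ι, ι, ← map_mul, ← map_sub, proj_c0_eq_zero_iff]
  exact tendsto_iff_norm_sub_tendsto_zero.1 h

theorem ι_mul_eq_of_tendsto {X : lp (fun _ : ℕ => A) ∞} {a b : A}
    (h : Filter.Tendsto (fun n => a * X n) Filter.atTop (nhds b)) :
    ι a * (c0 A).proj X = ι b := by
  rw [← sub_eq_zero, ι, ι, ← map_mul, ← map_sub, proj_c0_eq_zero_iff]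
  exact tendsto_iff_norm_sub_tendsto_zero.1 h

theorem exists_isSeqUnit_of_tendsto {h : ℕ → A} (hb : ∀ n, ‖h n‖ ≤ 1)
    (hl : ∀ a, Filter.Tendsto (fun n => h n * a) Filter.atTop (nhds a))
    (hr : ∀ a, Filter.Tendsto (fun n => a * h n) Filter.atTop (nhds a)) :
    ∃ e : SeqAlg A, IsSeqUnit e := by
  have hm : Memℓp h ∞ := memℓp_infty ⟨1, by rintro _ ⟨n, rfl⟩; exact hb n⟩
  exact ⟨(c0 A).proj ⟨h, hm⟩, fun a => ⟨mul_ι_eq_of_tendsto (X := ⟨h, hm⟩) (hl a),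
    ι_mul_eq_of_tendsto (X := ⟨h, hm⟩) (hr a)⟩⟩

theorem F_proj_eq_iff (x y : CentralSeq A) :
    (Ann A).proj x = (Ann A).proj y ↔ ∀ a, (x : SeqAlg A) * ι a = (y : SeqAlg A) * ι a := by
  rw [(Ann A).proj_eq_iff]
  refine forall_congr' fun a => ?_
  change ((x : SeqAlg A) - (y : SeqAlg A)) * ι a = 0 ↔ _
  rw [sub_mul, sub_eq_zero]

/-- A unit of `F(A)` must fix the class of an approximate unit e, so x e a = e a for all a, and e a
= a. Without an approximate unit this direction would not be available. -/
theorem isUnitElement_F_proj_iff (hA : ∃ e : SeqAlg A, IsSeqUnit e) (x : CentralSeq A) :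
    IsUnitElement ((Ann A).proj x) ↔ ∀ a, (x : SeqAlg A) * ι a = ι a := by
  constructor
  · intro hx a
    obtain ⟨e, he⟩ := hA
    have h := (hx ((Ann A).proj ⟨e, he.mem_centralSeq⟩)).1
    rw [← map_mul, F_proj_eq_iff] at h
    have h : (x : SeqAlg A) * e * ι a = e * ι a := h a
    rwa [mul_assoc, (he a).1] at h
  · intro hx y
    obtain ⟨y, rfl⟩ := (Ann A).proj_surjective y
    rw [← map_mul, ← map_mul, F_proj_eq_iff, F_proj_eq_iff]
    refine ⟨fun a => ?_, fun a => ?_⟩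
    · change (x : SeqAlg A) * (y : SeqAlg A) * ι a = _
      rw [mul_assoc, ← mem_centralSeq_iff.1 y.2, ← mul_assoc, hx]
    · change (y : SeqAlg A) * (x : SeqAlg A) * ι a = _
      rw [mul_assoc, hx]

/-- The classes of the central sequences `x k` form a unitary representation of `K` on `F(A)`,
expressed by the action on `A`. -/
structure ActsAsRep {K : Type*} [Group K] (x : K → SeqAlg A) : Prop where
  mem_centralSeq : ∀ k, x k ∈ CentralSeq A
  map_one : ∀ a, x 1 * ι a = ι a
  map_mul : ∀ k l a, x (k * l) * ι a = x k * x l * ι a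
  star_mul_self : ∀ k a, star (x k) * x k * ι a = ι a
  mul_star_self : ∀ k a, x k * star (x k) * ι a = ι a

namespace ActsAsRep

variable {K : Type*} [Group K] {x : K → SeqAlg A} (hx : ActsAsRep x)
include hx

theorem comm (k : K) (a : A) : ι a * x k = x k * ι a := mem_centralSeq_iff.1 (hx.1 k) a

theorem comm_star (k : K) (a : A) : ι a * star (x k) = star (x k) * ι a :=
  mem_centralSeq_iff.1 (star_mem (hx.1 k)) a

end ActsAsRep

theorem isUnitaryRep_F_iff {K : Type*} [Group K] (hA : ∃ e : SeqAlg A, IsSeqUnit e)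
    (w : K → CentralSeq A) :
    IsUnitaryRep (fun k => (Ann A).proj (w k)) ↔ ActsAsRep fun k => (w k : SeqAlg A) := by
  constructor
  · rintro ⟨h1, h2, h3, h4⟩
    refine ⟨fun k => (w k).2, (isUnitElement_F_proj_iff hA _).1 h1, fun k l => ?_, fun k => ?_,
      fun k => ?_⟩
    · exact (F_proj_eq_iff (w (k * l)) (w k * w l)).1 (h2 k l)
    · exact (isUnitElement_F_proj_iff hA (star (w k) * w k)).1 (h3 k)
    · exact (isUnitElement_F_proj_iff hA (w k * star (w k))).1 (h4 k)
  · rintro ⟨-, h1, h2, h3, h4⟩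
    refine ⟨(isUnitElement_F_proj_iff hA _).2 h1, fun k l => ?_, fun k => ?_, fun k => ?_⟩
    · exact (F_proj_eq_iff (w (k * l)) (w k * w l)).2 (h2 k l)
    · exact (isUnitElement_F_proj_iff hA (star (w k) * w k)).2 (h3 k)
    · exact (isUnitElement_F_proj_iff hA (w k * star (w k))).2 (h4 k)

theorem ActsAsRep.map_of_surjective {K : Type*} [Group K] {x : K → SeqAlg A} (hx : ActsAsRep x)
    (φ : A →⋆ₙₐ[ℂ] B) (hs : Function.Surjective φ) : ActsAsRep fun k => SeqAlg.map φ (x k) := by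
  refine ⟨fun k => mem_centralSeq_iff.2 (hs.forall.2 fun a => ?_),
    hs.forall.2 fun a => ?_, fun k l => hs.forall.2 fun a => ?_,
    fun k => hs.forall.2 fun a => ?_, fun k => hs.forall.2 fun a => ?_⟩
  · rw [← SeqAlg.map_ι, ← _root_.map_mul, hx.comm, _root_.map_mul]
  · rw [← SeqAlg.map_ι, ← _root_.map_mul, hx.map_one]
  · simp only [← SeqAlg.map_ι, ← _root_.map_mul, hx.map_mul]
  · simp only [← SeqAlg.map_ι, ← _root_.map_mul, ← map_star, hx.star_mul_self]
  · simp only [← SeqAlg.map_ι, ← _root_.map_mul, ← map_star, hx.mul_star_self]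

/-- Pulls a representation back along an isomorphism; applied to the identification of `A` with the
fixed points of the dual action. -/
theorem ActsAsRep.exists_eq_map {K : Type*} [Group K] {w : K → SeqAlg B} (hw : ActsAsRep w)
    (φ : A →⋆ₙₐ[ℂ] B) (hφ : Function.Bijective φ) :
    ∃ x : K → SeqAlg A, ActsAsRep x ∧ ∀ k, w k = SeqAlg.map φ (x k) := by
  let e := StarAlgEquiv.ofBijective φ hφ
  let ψ : B →⋆ₙₐ[ℂ] A := (e.symm : B →⋆ₙₐ[ℂ] A)
  refine ⟨fun k => SeqAlg.map ψ (w k), hw.map_of_surjective ψ e.symm.surjective, fun k => ?_⟩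
  rw [SeqAlg.map_map]
  exact (SeqAlg.map_of_forall_eq (fun d => e.apply_symm_apply d) _).symm

theorem IsSeqUnit.map_of_surjective {e : SeqAlg A} (he : IsSeqUnit e)
    (φ : A →⋆ₙₐ[ℂ] B) (hs : Function.Surjective φ) : IsSeqUnit (SeqAlg.map φ e) := by
  refine hs.forall.2 fun a => ⟨?_, ?_⟩
  · rw [← SeqAlg.map_ι, ← map_mul, (he a).1]
  · rw [← SeqAlg.map_ι, ← map_mul, (he a).2]

theorem isApproximatelyRepresentable_iff {G : Type*} [CommGroup G] (α : G →* (A ≃⋆ₐ[ℂ] A))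
    (hα : ∃ e : SeqAlg (fixedPoints α), IsSeqUnit e) :
    IsApproximatelyRepresentable α ↔ ∃ w : G → SeqAlg (fixedPoints α), ActsAsRep w ∧
      ∀ g (a : A), ι (α g a) = fixedPointsIncl α (w g) * ι a * star (fixedPointsIncl α (w g)) := by
  constructor
  · rintro ⟨w, hw, h⟩
    exact ⟨fun g => w g, (isUnitaryRep_F_iff hα w).1 hw, h⟩
  · rintro ⟨w, hw, h⟩
    exact ⟨fun g => ⟨w g, hw.1 g⟩, (isUnitaryRep_F_iff hα _).2 hw, h⟩

/-- The Fourier transform combined with a lift from `F(A)` to `A^∞`. Arbitrary lifts will do,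
because all relations other than centrality are read off after multiplication by elements of `A`. -/
theorem hasRohlinProperty_iff_exists_actsAsRep {G K : Type*} [CommGroup G] [Fintype G]
    [CommGroup K] [Fintype K] {p : G →* K →* Circle} (hp : IsPerfectPairing p)
    (α : G →* (A ≃⋆ₐ[ℂ] A)) (hA : ∃ e : SeqAlg A, IsSeqUnit e) :
    HasRohlinProperty α ↔ ∃ x : K → SeqAlg A, ActsAsRep x ∧
      ∀ g k a, SeqAlg.map (α g : A →⋆ₙₐ[ℂ] A) (x k) * ι a = (p g k : ℂ) • (x k * ι a) := by
  rw [hasRohlinProperty_iff hp]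
  have key (g : G) (c : ℂ) (w : CentralSeq A) :
      F.map (α g) ((Ann A).proj w) = c • (Ann A).proj w ↔
      ∀ a, SeqAlg.map (α g : A →⋆ₙₐ[ℂ] A) (w : SeqAlg A) * ι a = c • ((w : SeqAlg A) * ι a) := by
    rw [← map_smul]
    refine (F_proj_eq_iff (CentralSeq.map (α g) w) (c • w)).trans (forall_congr' fun a => ?_)
    rw [← smul_mul_assoc]
    rfl
  constructor
  · rintro ⟨u, hu, h⟩
    choose w hw using fun k => (Ann A).proj_surjective (u k)
    obtain rfl : (fun k => (Ann A).proj (w k)) = u := funext hw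
    exact ⟨fun k => w k, (isUnitaryRep_F_iff hA w).1 hu, fun g k => (key g _ _).1 (h g k)⟩
  · rintro ⟨x, hx, h⟩
    exact ⟨fun k => (Ann A).proj ⟨x k, hx.1 k⟩, (isUnitaryRep_F_iff hA _).2 hx,
      fun g k => (key g _ _).2 (h g k)⟩

end SequenceAlgebra

/-! ### Automorphisms of sequence algebras -/

section SeqAut

variable {G A : Type*} [Group G] [NonUnitalCStarAlgebra A] (α : G →* (A ≃⋆ₐ[ℂ] A))

/-- The automorphism of `A^∞` induced by `α g`. -/
abbrev seqAut (g : G) : SeqAlg A →⋆ₙₐ[ℂ] SeqAlg A := SeqAlg.map (α g : A →⋆ₙₐ[ℂ] A)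

theorem aut_apply_aut_inv_apply (g : G) (a : A) : α g (α g⁻¹ a) = a := by
  rw [← StarAlgEquiv.mul_apply, ← map_mul, mul_inv_cancel, map_one]
  rfl

theorem seqAut_seqAut (g h : G) (x : SeqAlg A) : seqAut α g (seqAut α h x) = seqAut α (g * h) x := by
  obtain ⟨X, rfl⟩ := (c0 A).proj_surjective x
  rw [seqAut, seqAut, seqAut, map_mul α]
  rfl

theorem seqAut_one (x : SeqAlg A) : seqAut α 1 x = x :=
  SeqAlg.map_of_forall_eq (fun a => by rw [map_one]; rfl) x

theorem seqAut_ι (g : G) (a : A) : seqAut α g (ι a) = ι (α g a) := rfl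

theorem fixedPointsIncl_map_codRestrict {B : Type*} [NonUnitalCStarAlgebra B] (φ : B →⋆ₙₐ[ℂ] A)
    (hφ : ∀ b, φ b ∈ fixedPoints α) (x : SeqAlg B) :
    fixedPointsIncl α (SeqAlg.map (NonUnitalStarAlgHom.codRestrict φ (fixedPoints α) hφ) x) =
      SeqAlg.map φ x := by
  obtain ⟨X, rfl⟩ := (c0 B).proj_surjective x
  rfl

theorem fixedPointsIncl_ι (d : fixedPoints α) : fixedPointsIncl α (ι d) = ι (d : A) := rfl

theorem seqAut_fixedPointsIncl (g : G) (x : SeqAlg (fixedPoints α)) :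
    seqAut α g (fixedPointsIncl α x) = fixedPointsIncl α x := by
  obtain ⟨X, rfl⟩ := (c0 (fixedPoints α)).proj_surjective x
  exact congrArg (c0 A).proj (Subtype.ext (funext fun n => (X n).2 g))

theorem IsSeqUnit.seqAut {e : SeqAlg A} (he : IsSeqUnit e) (g : G) : IsSeqUnit (seqAut α g e) :=
  he.map_of_surjective _ (α g).surjective

end SeqAut

/-! ### The sequence algebra of the crossed product -/

section Monomials

variable {G A : Type*} [Group G] [Fintype G] [NonUnitalCStarAlgebra A] (α : G →* (A ≃⋆ₐ[ℂ] A))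

open Classical in
/-- The element `a λ_g` of the crossed product. -/
def monomial (g : G) (a : A) : crossedProduct α := ⟨regular α (Pi.single g a), _, rfl⟩

open Classical in
theorem coe_monomial_apply (g : G) (a : A) (h k : G) :
    (monomial α g a : CStarMatrix G G A) h k = if h * k⁻¹ = g then α h⁻¹ a else 0 := by
  change α h⁻¹ (Pi.single (M := fun _ => A) g a (h * k⁻¹)) = _
  rw [Pi.single_apply]
  split_ifs <;> simp

theorem monomial_add (g : G) (a b : A) :
    monomial α g (a + b) = monomial α g a + monomial α g b :=
  Subtype.ext <| CStarMatrix.ext fun h k => by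
    change (monomial α g (a + b) : CStarMatrix G G A) h k =
      (monomial α g a : CStarMatrix G G A) h k + (monomial α g b : CStarMatrix G G A) h k
    simp only [coe_monomial_apply]
    split_ifs <;> simp

theorem monomial_smul (g : G) (c : ℂ) (a : A) :
    monomial α g (c • a) = c • monomial α g a :=
  Subtype.ext <| CStarMatrix.ext fun h k => by
    change (monomial α g (c • a) : CStarMatrix G G A) h k =
      c • (monomial α g a : CStarMatrix G G A) h k
    simp only [coe_monomial_apply]
    split_ifs <;> simp

theorem monomial_mul_monomial (g h : G) (a b : A) :
    monomial α g a * monomial α h b = monomial α (g * h) (a * α g b) := by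
  classical
  refine Subtype.ext ((regular_mul α _ _).trans (congrArg (regular α) (funext fun k => ?_)))
  rw [Finset.sum_eq_single g]
  · simp only [Pi.single_apply, inv_mul_eq_iff_eq_mul]
    split_ifs <;> simp
  · intro s _ hs
    rw [Pi.single_eq_of_ne hs, zero_mul]
  · simp

theorem star_monomial (g : G) (a : A) :
    star (monomial α g a) = monomial α g⁻¹ (α g⁻¹ (star a)) := by
  classical
  refine Subtype.ext ((star_regular α _).trans (congrArg (regular α) (funext fun k => ?_)))
  simp only [Pi.single_apply]
  by_cases hk : k = g⁻¹
  · subst hk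
    simp
  · rw [if_neg hk, if_neg fun h => hk (by rw [← h, inv_inv]), star_zero, map_zero]

/-- The embedding of `A` into the crossed product. -/
def embed : A →⋆ₙₐ[ℂ] crossedProduct α where
  toFun := monomial α 1
  map_smul' c a := monomial_smul α 1 c a
  map_zero' := by simpa using monomial_smul α 1 0 0
  map_add' a b := monomial_add α 1 a b
  map_mul' a b := by rw [monomial_mul_monomial, one_mul, map_one]; rfl
  map_star' a := by rw [star_monomial, inv_one, map_one]; rfl

end Monomials

/-! ### Monomials and coefficients in the crossed product and its sequence algebra. -/

section CrossedProductCalculus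

variable {G A : Type*} [Group G] [Fintype G] [NonUnitalCStarAlgebra A] [PartialOrder A]
  [StarOrderedRing A] (α : G →* (A ≃⋆ₐ[ℂ] A))

/-- Since (a λ_g)(a λ_g)* = a a*, the C*-identity reduces the bound to contractivity of the
homomorphism `embed`. -/
theorem norm_monomial_le (g : G) (a : A) : ‖monomial α g a‖ ≤ ‖a‖ := by
  have h : monomial α g a * star (monomial α g a) = embed α (a * star a) := by
    rw [star_monomial, monomial_mul_monomial, mul_inv_cancel, aut_apply_aut_inv_apply]
    rfl
  have h2 : ‖monomial α g a‖ * ‖monomial α g a‖ ≤ ‖a‖ * ‖a‖ := by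
    rw [← CStarRing.norm_self_mul_star, ← CStarRing.norm_self_mul_star, h]
    exact NonUnitalStarAlgHom.norm_apply_le (embed α) _
  exact (mul_self_le_mul_self_iff (norm_nonneg _) (norm_nonneg _)).2 h2

/-- The bounded linear map `a ↦ a λ_g`. -/
def monomialL (g : G) : A →L[ℂ] crossedProduct α :=
  LinearMap.mkContinuous
    { toFun := monomial α g
      map_add' := monomial_add α g
      map_smul' := monomial_smul α g } 1
    fun a => by rw [one_mul]; exact norm_monomial_le α g a

/-- The bounded linear map `∑ g, f g λ_g ↦ f g`. -/
def coeffL (g : G) : crossedProduct α →L[ℂ] A :=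
  LinearMap.mkContinuous
    -- The (g, 1) entry of `regular α f` is α_{g⁻¹}(f g), which α_g undoes.
    { toFun := fun M => α g ((M : CStarMatrix G G A) g 1)
      map_add' := fun M N => map_add (α g) _ _
      map_smul' := fun c M => map_smul (α g) c _ } 1
    fun M => by
      rw [one_mul]
      exact (NonUnitalStarAlgHom.norm_apply_le (α g) _).trans CStarMatrix.norm_entry_le_norm

theorem coeffL_regular (g : G) (f : G → A) : coeffL α g ⟨regular α f, f, rfl⟩ = f g := by
  change α g (α g⁻¹ (f (g * 1⁻¹))) = f g
  rw [aut_apply_aut_inv_apply, inv_one, mul_one]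

theorem coeffL_monomial (g : G) (a : A) : coeffL α g (monomial α g a) = a := by
  classical
  exact (coeffL_regular α g _).trans (Pi.single_eq_same _ _)

theorem coeffL_monomial_of_ne {g h : G} (hgh : g ≠ h) (a : A) :
    coeffL α g (monomial α h a) = 0 := by
  classical
  exact (coeffL_regular α g _).trans (Pi.single_eq_of_ne hgh _)

theorem ext_coeffL {M N : crossedProduct α} (h : ∀ g, coeffL α g M = coeffL α g N) : M = N := by
  obtain ⟨_, f, rfl⟩ := M
  obtain ⟨_, f', rfl⟩ := N
  obtain rfl : f = f' := funext fun g => by simpa only [coeffL_regular] using h g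
  rfl

theorem sum_monomial_coeffL (M : crossedProduct α) :
    ∑ g, monomial α g (coeffL α g M) = M := by
  refine ext_coeffL α fun g => ?_
  rw [map_sum, Finset.sum_eq_single g]
  · rw [coeffL_monomial]
  · exact fun h _ hgh => coeffL_monomial_of_ne α hgh.symm _
  · simp

/-- The map `x ↦ x λ_g` from `A^∞` to `(A ⋊ G)^∞`. -/
def seqMonomial (g : G) : SeqAlg A →ₗ[ℂ] SeqAlg (crossedProduct α) := SeqAlg.mapL (monomialL α g)

/-- The map `∑ g, x g λ_g ↦ x g` from `(A ⋊ G)^∞` to `A^∞`. -/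
def seqCoeff (g : G) : SeqAlg (crossedProduct α) →ₗ[ℂ] SeqAlg A := SeqAlg.mapL (coeffL α g)

theorem seqMonomial_ι (g : G) (a : A) : seqMonomial α g (ι a) = ι (monomial α g a) := rfl

theorem seqMonomial_mul (g h : G) (x y : SeqAlg A) :
    seqMonomial α g x * seqMonomial α h y = seqMonomial α (g * h) (x * seqAut α g y) := by
  obtain ⟨X, rfl⟩ := (c0 A).proj_surjective x
  obtain ⟨Y, rfl⟩ := (c0 A).proj_surjective y
  exact congrArg (c0 (crossedProduct α)).proj
    (Subtype.ext (funext fun n => monomial_mul_monomial α g h (X n) (Y n)))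

theorem star_seqMonomial (g : G) (x : SeqAlg A) :
    star (seqMonomial α g x) = seqMonomial α g⁻¹ (seqAut α g⁻¹ (star x)) := by
  obtain ⟨X, rfl⟩ := (c0 A).proj_surjective x
  exact congrArg (c0 (crossedProduct α)).proj
    (Subtype.ext (funext fun n => star_monomial α g (X n)))

theorem seqCoeff_seqMonomial (g : G) (x : SeqAlg A) :
    seqCoeff α g (seqMonomial α g x) = x := by
  obtain ⟨X, rfl⟩ := (c0 A).proj_surjective x
  exact congrArg (c0 A).proj (Subtype.ext (funext fun n => coeffL_monomial α g (X n)))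

theorem seqMonomial_injective (g : G) : Function.Injective (seqMonomial α g) :=
  Function.LeftInverse.injective (seqCoeff_seqMonomial α g)

theorem map_embed (x : SeqAlg A) : SeqAlg.map (embed α) x = seqMonomial α 1 x := by
  obtain ⟨X, rfl⟩ := (c0 A).proj_surjective x
  rfl

theorem ι_crossedProduct (M : crossedProduct α) :
    ι M = ∑ g, seqMonomial α g (ι (coeffL α g M)) := by
  conv_lhs => rw [← sum_monomial_coeffL α M, ι_sum]
  rfl

theorem forall_mul_ι_eq_mul_ι {x y : SeqAlg (crossedProduct α)}
    (h : ∀ g a, x * seqMonomial α g (ι a) = y * seqMonomial α g (ι a)) (M : crossedProduct α) :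
    x * ι M = y * ι M := by
  simp only [ι_crossedProduct, Finset.mul_sum, h]

theorem forall_mul_ι_eq_ι {x : SeqAlg (crossedProduct α)}
    (h : ∀ g a, x * seqMonomial α g (ι a) = seqMonomial α g (ι a)) (M : crossedProduct α) :
    x * ι M = ι M := by
  simp only [ι_crossedProduct, Finset.mul_sum, h]

theorem mem_centralSeq_crossedProduct {x : SeqAlg (crossedProduct α)}
    (h : ∀ g a, seqMonomial α g (ι a) * x = x * seqMonomial α g (ι a)) :
    x ∈ CentralSeq (crossedProduct α) :=
  mem_centralSeq_iff.2 fun M => by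
    simp only [ι_crossedProduct, Finset.mul_sum, Finset.sum_mul, h]

theorem IsSeqUnit.seqMonomial_one {e : SeqAlg A} (he : IsSeqUnit e) :
    IsSeqUnit (seqMonomial α 1 e) := by
  refine fun M => ⟨forall_mul_ι_eq_ι α (fun g a => ?_) M, ?_⟩
  · rw [seqMonomial_mul, one_mul, seqAut_one, (he a).1]
  -- Here e is moved past λ_g and becomes α_g(e), which is again an approximate unit.
  · simp only [ι_crossedProduct, Finset.sum_mul, seqMonomial_mul, mul_one, (he.seqAut α _ _).2]

end CrossedProductCalculus

/-! ### Spectral components and fixed points of the dual action. -/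

section DualCalculus

variable {G A : Type*} [CommGroup G] [Fintype G] [NonUnitalCStarAlgebra A] [PartialOrder A]
  [StarOrderedRing A] (α : G →* (A ≃⋆ₐ[ℂ] A))

theorem coeffL_dualAction (γ : G →* Circle) (g : G) (M : crossedProduct α) :
    coeffL α g (dualAction α γ M) = (γ g : ℂ) • coeffL α g M := by
  change α g ((γ (g * 1⁻¹) : ℂ) • (M : CStarMatrix G G A) g 1) = _
  rw [map_smul, inv_one, mul_one]
  rfl

theorem dualAction_monomial (γ : G →* Circle) (g : G) (a : A) :
    dualAction α γ (monomial α g a) = (γ g : ℂ) • monomial α g a := by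
  refine ext_coeffL α fun h => ?_
  rw [coeffL_dualAction, map_smul]
  by_cases hgh : h = g
  · rw [hgh]
  · rw [coeffL_monomial_of_ne α hgh, smul_zero, smul_zero]

/-- Orthogonality of characters: averaging the dual action against the conjugate of γ(g) projects
onto the eigenspace A λ_g. -/
theorem monomial_coeffL (g : G) (M : crossedProduct α) :
    monomial α g (coeffL α g M) =
      (Fintype.card G : ℂ)⁻¹ • ∑ γ : G →* Circle, ((γ g)⁻¹ : Circle) • dualAction α γ M := by
  have hn : (Fintype.card G : ℂ) ≠ 0 := Nat.cast_ne_zero.2 Fintype.card_ne_zero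
  refine ext_coeffL α fun h => ?_
  have h1 : coeffL α h (∑ γ : G →* Circle, ((γ g)⁻¹ : Circle) • dualAction α γ M) =
      (∑ γ : G →* Circle, (γ (g⁻¹ * h) : ℂ)) • coeffL α h M := by
    rw [map_sum, Finset.sum_smul]
    refine Finset.sum_congr rfl fun γ _ => ?_
    rw [Circle.smul_def, map_smul, coeffL_dualAction, smul_smul, ← Circle.coe_mul, ← map_inv,
      ← map_mul]
  rw [map_smul, h1]
  by_cases hgh : h = g
  · subst hgh
    rw [coeffL_monomial]
    simp [card_circleHom, smul_smul, hn]
  · have h2 := sum_circleHom_eq_zero (MonoidHom.eval (M := G) (N := Circle) (g⁻¹ * h))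
      (exists_circleHom_ne_one fun h' => hgh (by rwa [inv_mul_eq_one, eq_comm] at h'))
    simp only [MonoidHom.eval_apply_apply] at h2
    rw [coeffL_monomial_of_ne α hgh, h2, zero_smul, smul_zero]

theorem map_dualAction_seqMonomial (γ : G →* Circle) (g : G) (x : SeqAlg A) :
    seqAut (dualAction α) γ (seqMonomial α g x) = (γ g : ℂ) • seqMonomial α g x := by
  obtain ⟨X, rfl⟩ := (c0 A).proj_surjective x
  exact congrArg (c0 (crossedProduct α)).proj
    (Subtype.ext (funext fun n => dualAction_monomial α γ g (X n)))

theorem seqMonomial_seqCoeff (g : G) (x : SeqAlg (crossedProduct α)) :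
    seqMonomial α g (seqCoeff α g x) = (Fintype.card G : ℂ)⁻¹ •
      ∑ γ : G →* Circle, (((γ g)⁻¹ : Circle) : ℂ) • seqAut (dualAction α) γ x := by
  obtain ⟨X, rfl⟩ := (c0 (crossedProduct α)).proj_surjective x
  simp only [SeqAlg.map_proj, ← map_smul, ← map_sum]
  refine congrArg (c0 (crossedProduct α)).proj (Subtype.ext (funext fun n => ?_))
  refine (monomial_coeffL α g (X n)).trans ?_
  rw [lp.coeFn_smul, Pi.smul_apply, lp.coeFn_sum, Finset.sum_apply]
  refine congrArg _ (Finset.sum_congr rfl fun γ _ => ?_)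
  exact (map_smul (dualAction α γ) (((γ g)⁻¹ : Circle) : ℂ) (X n)).symm

/-- The embedding of `A` onto the fixed point algebra of the dual action. -/
def embedFixed : A →⋆ₙₐ[ℂ] fixedPoints (dualAction α) :=
  NonUnitalStarAlgHom.codRestrict (embed α) (fixedPoints (dualAction α)) fun a γ => by
    refine (dualAction_monomial α γ 1 a).trans ?_
    rw [map_one, Circle.coe_one, one_smul]
    rfl

theorem embedFixed_bijective : Function.Bijective (embedFixed α) := by
  constructor
  · intro a b h
    have h1 : monomial α 1 a = monomial α 1 b := congrArg Subtype.val h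
    rw [← coeffL_monomial α 1 a, h1, coeffL_monomial]
  · rintro ⟨M, hM⟩
    refine ⟨coeffL α 1 M, Subtype.ext (ext_coeffL α fun g => ?_)⟩
    change coeffL α g (monomial α 1 (coeffL α 1 M)) = coeffL α g M
    by_cases hg : g = 1
    · rw [hg, coeffL_monomial]
    -- A character with γ(g) ≠ 1 forces the coefficient of λ_g in a fixed element to vanish.
    · obtain ⟨γ, hγ⟩ := exists_circleHom_ne_one hg
      have h := congrArg (coeffL α g) (hM γ)
      rw [coeffL_dualAction, ← sub_eq_zero] at h
      nth_rw 2 [← one_smul ℂ (coeffL α g M)] at h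
      rw [← sub_smul, smul_eq_zero, sub_eq_zero] at h
      rw [coeffL_monomial_of_ne α hg, h.resolve_left fun h' => hγ (Circle.ext h')]

theorem fixedPointsIncl_map_embedFixed (x : SeqAlg A) :
    fixedPointsIncl (dualAction α) (SeqAlg.map (embedFixed α) x) = seqMonomial α 1 x :=
  (fixedPointsIncl_map_codRestrict (dualAction α) (embed α) _ x).trans (map_embed α x)

end DualCalculus

/-! ### Rohlin actions and approximately representable dual actions -/

section RohlinDual

variable {G A : Type*} [CommGroup G] [Fintype G] [NonUnitalCStarAlgebra A] [PartialOrder A]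
  [StarOrderedRing A] (α : G →* (A ≃⋆ₐ[ℂ] A))

theorem star_circle_coe (c : Circle) : star (c : ℂ) = ((c⁻¹ : Circle) : ℂ) := by
  rw [Complex.star_def, ← Circle.coe_inv_eq_conj]

/-- Given a unitary `x ∈ F(A)` and `y ∈ A^∞`, the relation `y = c⁻¹ x` modulo the annihilator
is equivalent to `x a y* = c a` for all `a ∈ A`. -/
theorem eigen_iff_conj {B K : Type*} [NonUnitalCStarAlgebra B] [Group K] {x : K → SeqAlg B}
    (hx : ActsAsRep x) (k : K) (y : SeqAlg B) (c : Circle) :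
    (∀ b, y * ι b = ((c⁻¹ : Circle) : ℂ) • (x k * ι b)) ↔
      ∀ b, x k * ι b * star y = (c : ℂ) • ι b := by
  constructor
  · intro h b
    -- No centrality of y is assumed, so b y* is reached only as the adjoint of y b*.
    have h1 := congrArg star (h (star b))
    rw [star_mul, star_smul, star_mul, ← ι_star, star_star, star_circle_coe, inv_inv] at h1
    rw [mul_assoc, h1, mul_smul_comm, hx.comm_star, ← mul_assoc, hx.mul_star_self]
  · intro h b
    have h1 := congrArg star (h (star b))
    rw [star_mul, star_mul, star_smul, ← ι_star, star_star, star_star, star_circle_coe] at h1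
    -- Inserting x* x and moving b past x* produces y b x*, the adjoint form of the hypothesis.
    calc y * ι b = y * (star (x k) * x k * ι b) := by rw [hx.star_mul_self]
      _ = y * (ι b * star (x k)) * x k := by
        rw [hx.comm_star, mul_assoc (star (x k)), ← hx.comm]
        simp only [mul_assoc]
      _ = ((c⁻¹ : Circle) : ℂ) • (x k * ι b) := by rw [h1, smul_mul_assoc, hx.comm]

/-- Passing x* to the left of λ_g turns it into α_g(x*). This is how the action of α on x becomes
visible in conjugation by x. -/
theorem seqMonomial_conj (g : G) (x : SeqAlg A) (a : A) :
    seqMonomial α 1 x * seqMonomial α g (ι a) * star (seqMonomial α 1 x) =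
      seqMonomial α g (x * ι a * star (seqAut α g x)) := by
  rw [star_seqMonomial, seqMonomial_mul, seqMonomial_mul, inv_one, one_mul, mul_one, seqAut_one,
    seqAut_one, map_star]

/-- On each a λ_g the implementation condition reads x_γ a α_g(x_γ)* = γ(g) a, which is
`eigen_iff_conj` for y = α_g(x_γ) and c = γ(g). The monomials span the crossed product, and λ_g can
be cancelled. -/
theorem dualAction_eq_conj_iff {x : (G →* Circle) → SeqAlg A} (hx : ActsAsRep x) :
    (∀ g γ a, seqAut α g (x γ) * ι a =
      ((MonoidHom.eval⁻¹ : G →* (G →* Circle) →* Circle) g γ : ℂ) • (x γ * ι a)) ↔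
    ∀ γ (M : crossedProduct α), ι (dualAction α γ M) =
      seqMonomial α 1 (x γ) * ι M * star (seqMonomial α 1 (x γ)) := by
  have key (g : G) (γ : G →* Circle) := eigen_iff_conj hx γ (seqAut α g (x γ)) (γ g)
  constructor
  · intro h γ M
    rw [ι_crossedProduct, ι_crossedProduct, Finset.mul_sum, Finset.sum_mul]
    refine Finset.sum_congr rfl fun g _ => ?_
    rw [seqMonomial_conj, (key g γ).1 (h g γ), coeffL_dualAction, ι_smul]
  · intro h g γ
    refine (key g γ).2 fun a => seqMonomial_injective α g ?_
    rw [← seqMonomial_conj, seqMonomial_ι, ← h, dualAction_monomial, map_smul, seqMonomial_ι,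
      ι_smul]

theorem hasRohlinProperty_iff_isApproximatelyRepresentable_dualAction
    (hA : ∃ e : SeqAlg A, IsSeqUnit e) :
    HasRohlinProperty α ↔ IsApproximatelyRepresentable (dualAction α) := by
  have hs : Function.Surjective (embedFixed α) := (embedFixed_bijective α).2
  have hD : ∃ e : SeqAlg (fixedPoints (dualAction α)), IsSeqUnit e := by
    obtain ⟨e, he⟩ := hA
    exact ⟨_, he.map_of_surjective (embedFixed α) hs⟩
  rw [hasRohlinProperty_iff_exists_actsAsRep isPerfectPairing_eval_inv α hA,
    isApproximatelyRepresentable_iff _ hD]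
  constructor
  · rintro ⟨x, hx, h⟩
    refine ⟨fun γ => SeqAlg.map (embedFixed α) (x γ), hx.map_of_surjective _ hs, fun γ M => ?_⟩
    rw [fixedPointsIncl_map_embedFixed]
    exact (dualAction_eq_conj_iff α hx).1 h γ M
  · rintro ⟨w, hw, h⟩
    obtain ⟨x, hx, hwx⟩ := hw.exists_eq_map (embedFixed α) (embedFixed_bijective α)
    refine ⟨x, hx, (dualAction_eq_conj_iff α hx).2 fun γ M => ?_⟩
    have h1 : fixedPointsIncl (dualAction α) (w γ) = seqMonomial α 1 (x γ) :=
      (congrArg (fixedPointsIncl (dualAction α)) (hwx γ)).trans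
        (fixedPointsIncl_map_embedFixed α (x γ))
    exact (h γ M).trans (by rw [h1])

end RohlinDual

/-! ### Averaging over the group -/

section Average

variable {G A : Type*} [Group G] [Fintype G] [NonUnitalCStarAlgebra A] (α : G →* (A ≃⋆ₐ[ℂ] A))

/-- The conditional expectation `a ↦ |G|⁻¹ ∑ g, α_g(a)` onto the fixed point algebra. -/
def avgL : A →L[ℂ] fixedPoints α :=
  LinearMap.mkContinuous
    { toFun := fun a => ⟨(Fintype.card G : ℂ)⁻¹ • ∑ g, α g a, fun h => by
        rw [map_smul, map_sum]
        congr 1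
        refine Fintype.sum_equiv (Equiv.mulLeft h) _ _ fun g => ?_
        rw [← StarAlgEquiv.mul_apply, ← map_mul, Equiv.coe_mulLeft]⟩
      map_add' := fun a b => Subtype.ext <| by
        change (Fintype.card G : ℂ)⁻¹ • ∑ g, α g (a + b) =
          (Fintype.card G : ℂ)⁻¹ • ∑ g, α g a + (Fintype.card G : ℂ)⁻¹ • ∑ g, α g b
        simp only [map_add, Finset.sum_add_distrib, smul_add]
      map_smul' := fun c a => Subtype.ext <| by
        change (Fintype.card G : ℂ)⁻¹ • ∑ g, α g (c • a) =
          c • (Fintype.card G : ℂ)⁻¹ • ∑ g, α g a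
        simp only [map_smul, ← Finset.smul_sum]
        rw [smul_comm] } 1
    fun a => by
      change ‖(Fintype.card G : ℂ)⁻¹ • ∑ g, α g a‖ ≤ 1 * ‖a‖
      have h : ‖∑ g, α g a‖ ≤ Fintype.card G * ‖a‖ := by
        refine (norm_sum_le_of_le (f := fun g => α g a) Finset.univ
          fun g _ => NonUnitalStarAlgHom.norm_apply_le (α g) a).trans_eq ?_
        simp
      rw [norm_smul, one_mul, norm_inv, Complex.norm_natCast, inv_mul_le_iff₀ (by positivity)]
      exact h

theorem coe_avgL (a : A) : (avgL α a : A) = (Fintype.card G : ℂ)⁻¹ • ∑ g, α g a := rfl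

theorem inv_card_smul_sum_const {M : Type*} [AddCommGroup M] [Module ℂ M] (m : M) :
    (Fintype.card G : ℂ)⁻¹ • ∑ _g : G, m = m := by
  rw [Finset.sum_const, Finset.card_univ, ← Nat.cast_smul_eq_nsmul ℂ, smul_smul,
    inv_mul_cancel₀ (Nat.cast_ne_zero.2 Fintype.card_ne_zero), one_smul]

theorem avgL_coe (d : fixedPoints α) : avgL α (d : A) = d := by
  refine Subtype.ext ?_
  rw [coe_avgL]
  simp only [d.2 _, inv_card_smul_sum_const]

/-- The map `A^∞ → (A^α)^∞` induced by averaging over `G`. -/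
def seqAvg : SeqAlg A →ₗ[ℂ] SeqAlg (fixedPoints α) := SeqAlg.mapL (avgL α)

theorem seqAvg_fixedPointsIncl (x : SeqAlg (fixedPoints α)) :
    seqAvg α (fixedPointsIncl α x) = x := by
  obtain ⟨X, rfl⟩ := (c0 (fixedPoints α)).proj_surjective x
  exact congrArg (c0 (fixedPoints α)).proj (Subtype.ext (funext fun n => avgL_coe α (X n)))

theorem fixedPointsIncl_injective : Function.Injective (fixedPointsIncl α) :=
  Function.LeftInverse.injective (seqAvg_fixedPointsIncl α)

theorem fixedPointsIncl_seqAvg (x : SeqAlg A) :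
    fixedPointsIncl α (seqAvg α x) = (Fintype.card G : ℂ)⁻¹ • ∑ g, seqAut α g x := by
  obtain ⟨X, rfl⟩ := (c0 A).proj_surjective x
  simp only [seqAut, SeqAlg.map_proj, ← map_smul, ← map_sum]
  refine congrArg (c0 A).proj (Subtype.ext (funext fun n => ?_))
  rw [lp.coeFn_smul, Pi.smul_apply, lp.coeFn_sum, Finset.sum_apply]
  rfl

/-- Each α_g(e) is an approximate unit of `A`, hence so is their average; thus the fixed point
algebra contains an approximate unit for all of `A`. -/
theorem IsSeqUnit.fixedPointsIncl_seqAvg {e : SeqAlg A} (he : IsSeqUnit e) :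
    IsSeqUnit (fixedPointsIncl α (seqAvg α e)) := fun a => by
  rw [RohlinDuality.fixedPointsIncl_seqAvg, smul_mul_assoc, mul_smul_comm, Finset.sum_mul,
    Finset.mul_sum]
  simp only [((he.seqAut α _) a).1, ((he.seqAut α _) a).2, inv_card_smul_sum_const, and_self]

theorem IsSeqUnit.seqAvg {e : SeqAlg A} (he : IsSeqUnit e) : IsSeqUnit (seqAvg α e) := fun d => by
  constructor <;> refine fixedPointsIncl_injective α ?_
  · rw [map_mul, fixedPointsIncl_ι, (he.fixedPointsIncl_seqAvg α _).1]
  · rw [map_mul, fixedPointsIncl_ι, (he.fixedPointsIncl_seqAvg α _).2]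

/-- If X represents an approximate unit, its averages d_n are fixed and d_n a tends to a. -/
theorem dense_fixedPoints_mul (hA : ∃ e : SeqAlg A, IsSeqUnit e) (a : A) :
    a ∈ closure {b | ∃ d : fixedPoints α, b = d * a} := by
  obtain ⟨e, he⟩ := hA
  have h := (he.fixedPointsIncl_seqAvg α a).1
  obtain ⟨X, rfl⟩ := (c0 A).proj_surjective e
  have h1 : (c0 A).proj (lpMap (NonUnitalStarSubalgebraClass.subtype (fixedPoints α))
      (lpMapL (avgL α) X) * constSeq a - constSeq a) = 0 := by
    rw [map_sub, map_mul]
    exact sub_eq_zero.2 h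
  rw [proj_c0_eq_zero_iff] at h1
  refine mem_closure_of_tendsto (tendsto_iff_norm_sub_tendsto_zero.2 h1)
    (Filter.Eventually.of_forall fun n => ⟨avgL α (X n), rfl⟩)

/-- Elements of `(A^α)^∞` are determined on `A` by their action on `A^α`. -/
theorem fixedPointsIncl_mul_ι_congr (hA : ∃ e : SeqAlg A, IsSeqUnit e)
    {x y : SeqAlg (fixedPoints α)} (h : ∀ d, x * ι d = y * ι d) (a : A) :
    fixedPointsIncl α x * ι a = fixedPointsIncl α y * ι a := by
  -- x and y agree on products d a with d fixed, and a is a limit of such products.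
  have hcl := isClosed_mul_ι_eq_zero (fixedPointsIncl α x - fixedPointsIncl α y)
  have ha := closure_minimal (t := {b | (fixedPointsIncl α x - fixedPointsIncl α y) * ι b = 0})
    (by
      rintro _ ⟨d, rfl⟩
      change (fixedPointsIncl α x - fixedPointsIncl α y) * ι ((d : A) * a) = 0
      rw [ι_mul, ← mul_assoc, ← map_sub, ← fixedPointsIncl_ι, ← map_mul, sub_mul, h, sub_self,
        map_zero, zero_mul]) hcl (dense_fixedPoints_mul α hA a)
  rw [← sub_eq_zero, ← sub_mul]
  exact ha

/-- On the fixed points x agrees with the averaged approximate unit, hence also on `A`, where the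
latter acts as the identity. -/
theorem fixedPointsIncl_mul_ι_eq (hA : ∃ e : SeqAlg A, IsSeqUnit e)
    {x : SeqAlg (fixedPoints α)} (h : ∀ d, x * ι d = ι d) (a : A) :
    fixedPointsIncl α x * ι a = ι a := by
  obtain ⟨e, he⟩ := hA
  rw [fixedPointsIncl_mul_ι_congr α ⟨e, he⟩ (y := seqAvg α e)
    (fun d => (h d).trans (he.seqAvg α d).1.symm), (he.fixedPointsIncl_seqAvg α a).1]

end Average

/-! ### Approximately representable actions and Rohlin dual actions -/

section RepresentableDual

variable {G A : Type*} [CommGroup G] [Fintype G] [NonUnitalCStarAlgebra A] [PartialOrder A]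
  [StarOrderedRing A] (α : G →* (A ≃⋆ₐ[ℂ] A))

/-- Elements `W g ∈ A^∞` fixed by `α` and implementing `α` yield the central unitary
representation `g ↦ (W g)* λ_g` of the crossed product. -/
theorem actsAsRep_seqMonomial_star {W : G → SeqAlg A} (hfix : ∀ g h, seqAut α g (W h) = W h)
    (hmul : ∀ g h a, W (g * h) * ι a = W g * W h * ι a)
    (hsm : ∀ g a, star (W g) * W g * ι a = ι a)
    (hone : ∀ a, W 1 * ι a = ι a)
    (hconj : ∀ g a, ι (α g a) = W g * ι a * star (W g)) :
    ActsAsRep fun g => seqMonomial α g (star (W g)) := by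
  have hstar (g h : G) : seqAut α g (star (W h)) = star (W h) := by rw [map_star, hfix]
  -- W* α_g(a) = W* W a W* = a W*. This is what lets W* λ_g commute with `A`; invariance of W
  -- handles the λ_h.
  have hcomm (g : G) (a : A) : star (W g) * ι (α g a) = ι a * star (W g) := by
    rw [hconj, ← mul_assoc, ← mul_assoc, hsm]
  have hright (g h : G) (a : A) : seqMonomial α g (star (W g)) * seqMonomial α h (ι a) =
      seqMonomial α (g * h) (ι a * star (W g)) := by
    rw [seqMonomial_mul, seqAut_ι, hcomm]
  have hleft (g h : G) (x : SeqAlg A) : star (seqMonomial α g (star (W g))) * seqMonomial α h x =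
      seqMonomial α (g⁻¹ * h) (W g * seqAut α g⁻¹ x) := by
    rw [star_seqMonomial, star_star, hfix, seqMonomial_mul]
  refine ⟨fun g => mem_centralSeq_crossedProduct α fun h a => ?_, forall_mul_ι_eq_ι α fun h a => ?_,
    fun g k => forall_mul_ι_eq_mul_ι α fun h a => ?_, fun g => forall_mul_ι_eq_ι α fun h a => ?_,
    fun g => forall_mul_ι_eq_ι α fun h a => ?_⟩
  · rw [hright, seqMonomial_mul, hstar, mul_comm h g]
  · rw [hright, one_mul]
    congr 1
    calc ι a * star (W 1) = star (W 1 * ι (star a)) := by rw [star_mul, ← ι_star, star_star]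
      _ = ι a := by rw [hone, ← ι_star, star_star]
  · rw [hright, mul_assoc (seqMonomial α g _), hright, seqMonomial_mul, map_mul (seqAut α g), hstar,
      seqAut_ι, ← mul_assoc (star (W g)), hcomm, mul_assoc g k h, mul_assoc (ι a)]
    congr 1
    -- Adjoints reverse products, so multiplicativity is used for the pair (k, g); commutativity of
    -- `G` restores the order.
    have h1 := congrArg star (hmul k g (star a))
    rw [star_mul, star_mul, star_mul, ← ι_star, star_star] at h1
    rw [mul_comm g k, h1]
  · rw [mul_assoc, hright, hleft, map_mul (seqAut α _), hstar, seqAut_ι, ← mul_assoc (W g),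
      ← hconj, aut_apply_aut_inv_apply,
      inv_mul_cancel_left]
  · rw [mul_assoc, hleft, seqMonomial_mul, map_mul (seqAut α _), hfix, seqAut_ι, seqAut_ι,
      aut_apply_aut_inv_apply,
      mul_inv_cancel_left, ← mul_assoc, hsm]

/-- The eigenvectors are w(g)* λ_g, scaled by γ(g) under the dual action. The relations for w are
known only against fixed points and are first extended to `A` by density. -/
theorem hasRohlinProperty_dualAction_of_isApproximatelyRepresentable
    (hA : ∃ e : SeqAlg A, IsSeqUnit e) (h : IsApproximatelyRepresentable α) :
    HasRohlinProperty (dualAction α) := by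
  have hD : ∃ e : SeqAlg (fixedPoints α), IsSeqUnit e := hA.imp' (seqAvg α) fun _ he => he.seqAvg α
  have hB : ∃ e : SeqAlg (crossedProduct α), IsSeqUnit e :=
    hA.imp' (seqMonomial α 1) fun _ he => he.seqMonomial_one α
  obtain ⟨w, hw, hconj⟩ := (isApproximatelyRepresentable_iff α hD).1 h
  refine (hasRohlinProperty_iff_exists_actsAsRep isPerfectPairing_id (dualAction α) hB).2
    ⟨_, actsAsRep_seqMonomial_star α (W := fun g => fixedPointsIncl α (w g))
      (fun g h => seqAut_fixedPointsIncl α g (w h)) (fun g h a => ?_) (fun g a => ?_)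
      (fixedPointsIncl_mul_ι_eq α hA hw.map_one) hconj, fun γ g M => ?_⟩
  · rw [← map_mul]
    exact fixedPointsIncl_mul_ι_congr α hA (hw.map_mul g h) a
  · rw [← map_star, ← map_mul]
    exact fixedPointsIncl_mul_ι_eq α hA (hw.star_mul_self g) a
  · rw [← smul_mul_assoc]
    exact congrArg (· * ι M) (map_dualAction_seqMonomial α γ g _)

/-- Replacing each `x k` by a central element with the same class in `F(A)`. -/
theorem ActsAsRep.congr {B K : Type*} [NonUnitalCStarAlgebra B] [Group K] {x y : K → SeqAlg B}
    (hx : ActsAsRep x) (hl : ∀ k b, y k * ι b = x k * ι b) (hr : ∀ k b, ι b * y k = ι b * x k) :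
    ActsAsRep y := by
  have hs (k : K) (b : B) : star (y k) * ι b = star (x k) * ι b := by
    have h := congrArg star (hr k (star b))
    rwa [star_mul, star_mul, ← ι_star, star_star] at h
  refine ⟨fun k => mem_centralSeq_iff.2 fun b => ?_, fun b => ?_, fun k l b => ?_, fun k b => ?_,
    fun k b => ?_⟩
  · rw [hr, hl, hx.comm]
  · rw [hl, hx.map_one]
  · rw [hl, hx.map_mul, mul_assoc (y k), hl, ← hx.comm, ← mul_assoc (y k), hl, mul_assoc (x k) (ι b),
      hx.comm, ← mul_assoc]
  · rw [mul_assoc, hl, ← hx.comm, ← mul_assoc, hs, mul_assoc, hx.comm, ← mul_assoc,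
      hx.star_mul_self]
  · rw [mul_assoc, hs, ← hx.comm_star, ← mul_assoc, hl, mul_assoc, hx.comm_star, ← mul_assoc,
      hx.mul_star_self]

/-- A central unitary representation by eigenvectors of the dual action is given by elements of
`A^∞ λ_g`. -/
theorem actsAsRep_seqMonomial_seqCoeff {u : G → SeqAlg (crossedProduct α)} (hu : ActsAsRep u)
    (h : ∀ γ g M, seqAut (dualAction α) γ (u g) * ι M = (γ g : ℂ) • (u g * ι M)) :
    ActsAsRep fun g => seqMonomial α g (seqCoeff α g (u g)) := by
  have hc (γ : G →* Circle) := hu.map_of_surjective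
    (dualAction α γ : crossedProduct α →⋆ₙₐ[ℂ] crossedProduct α) (dualAction α γ).surjective
  have h1 (γ : G →* Circle) (g : G) (M : crossedProduct α) :
      ((((γ g)⁻¹ : Circle) : ℂ) • seqAut (dualAction α) γ (u g)) * ι M = u g * ι M := by
    rw [smul_mul_assoc, h, smul_smul, ← Circle.coe_mul, inv_mul_cancel, Circle.coe_one, one_smul]
  -- Agreement under right multiplication carries over to left multiplication because both u g and
  -- its image under the dual action are central.
  have h2 (γ : G →* Circle) (g : G) (M : crossedProduct α) :
      ι M * ((((γ g)⁻¹ : Circle) : ℂ) • seqAut (dualAction α) γ (u g)) = ι M * u g := by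
    rw [hu.comm, ← h1, mul_smul_comm, smul_mul_assoc]
    exact congrArg _ ((hc γ).comm g M)
  -- The normalisation is by |G| while the sum runs over the dual group, which has the same
  -- cardinality.
  have h3 (m : SeqAlg (crossedProduct α)) :
      (Fintype.card G : ℂ)⁻¹ • ∑ _γ : G →* Circle, m = m := by
    rw [← card_circleHom, inv_card_smul_sum_const]
  refine hu.congr (fun g M => ?_) fun g M => ?_
  · rw [seqMonomial_seqCoeff, smul_mul_assoc, Finset.sum_mul]
    simp only [h1, h3]
  · rw [seqMonomial_seqCoeff, mul_smul_comm, Finset.mul_sum]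
    simp only [h2, h3]

/-- A central unitary representation `g ↦ v g λ_g` of the crossed product yields the unitary
representation of `G` implementing `α`, given by the averages of the `(v g)*`. -/
theorem isApproximatelyRepresentable_of_actsAsRep_seqMonomial
    (hD : ∃ e : SeqAlg (fixedPoints α), IsSeqUnit e) {v : G → SeqAlg A}
    (hv : ActsAsRep fun g => seqMonomial α g (v g)) : IsApproximatelyRepresentable α := by
  -- Centrality of v_g λ_g tested on a λ_h. The right-hand side does not involve h, so all α_h(v_g)
  -- agree under left multiplication by `A`.
  have hcomm (g h : G) (a : A) : ι a * seqAut α h (v g) = v g * ι (α g a) := by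
    have h1 := hv.comm g (monomial α h a)
    rw [← seqMonomial_ι, seqMonomial_mul, seqMonomial_mul, mul_comm h g, seqAut_ι] at h1
    exact seqMonomial_injective α _ h1
  have hcomm1 (g : G) (a : A) : ι a * v g = v g * ι (α g a) := by
    rw [← hcomm g 1, seqAut_one]
  -- The analogue for right multiplication by `A`: α_h is applied to the case h = 1 of `hcomm`, with
  -- the argument chosen so that α_h α_g carries it to a.
  have hleft (g h : G) (a : A) : seqAut α h (v g) * ι a = v g * ι a := by
    have h1 := congrArg (seqAut α h) (hcomm1 g (α g⁻¹ (α h⁻¹ a)))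
    have h2 : α g (α h (α g⁻¹ (α h⁻¹ a))) = a := by
      simp only [← StarAlgEquiv.mul_apply, ← map_mul]
      rw [mul_inv_cancel_comm_assoc, mul_inv_cancel, map_one]
      rfl
    rw [map_mul, map_mul, seqAut_ι, seqAut_ι, hcomm, h2, aut_apply_aut_inv_apply,
      aut_apply_aut_inv_apply] at h1
    exact h1.symm
  have hone (a : A) : v 1 * ι a = ι a := by
    have h1 := hv.map_one (monomial α 1 a)
    rw [← seqMonomial_ι, seqMonomial_mul, one_mul, seqAut_one] at h1
    exact seqMonomial_injective α _ h1
  have hmul (g k : G) (a : A) : v (g * k) * ι a = v g * v k * ι a := by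
    have h1 := hv.map_mul g k (monomial α 1 (α (g * k)⁻¹ a))
    rw [← seqMonomial_ι, mul_assoc, seqMonomial_mul, seqMonomial_mul, seqMonomial_mul,
      map_mul (seqAut α _), seqAut_seqAut, seqAut_ι, aut_apply_aut_inv_apply, mul_assoc g k 1, hleft,
      ← mul_assoc (v g)] at h1
    exact seqMonomial_injective α _ h1
  have hsm (g : G) (a : A) : star (v g) * v g * ι a = ι a := by
    have h1 := hv.star_mul_self g (monomial α 1 (α g⁻¹ a))
    rw [← seqMonomial_ι, mul_assoc, star_seqMonomial, seqMonomial_mul, seqMonomial_mul,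
      inv_mul_cancel_left, seqAut_ι, aut_apply_aut_inv_apply, ← map_mul] at h1
    have h2 := congrArg (seqAut α g) (seqMonomial_injective α _ h1)
    rwa [seqAut_seqAut, mul_inv_cancel, seqAut_one, seqAut_ι, aut_apply_aut_inv_apply,
      ← mul_assoc] at h2
  have hms (g : G) (a : A) : v g * star (v g) * ι a = ι a := by
    have h1 := hv.mul_star_self g (monomial α 1 a)
    rw [← seqMonomial_ι, mul_assoc, star_seqMonomial, seqMonomial_mul, seqMonomial_mul,
      mul_inv_cancel_left, map_mul (seqAut α _), seqAut_seqAut, seqAut_seqAut,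
      mul_inv_cancel, seqAut_one,
      seqAut_one, ← mul_assoc] at h1
    exact seqMonomial_injective α _ h1
  -- Averaging makes v_g exactly invariant; `hVl` and `hVr` show that its products with `A` on
  -- either side are unchanged.
  set V : G → SeqAlg A := fun g => fixedPointsIncl α (seqAvg α (v g)) with hV
  have hVl (g : G) (a : A) : V g * ι a = v g * ι a := by
    simp only [hV, fixedPointsIncl_seqAvg, smul_mul_assoc, Finset.sum_mul, hleft,
      inv_card_smul_sum_const]
  have hVr (g : G) (a : A) : ι a * V g = ι a * v g := by
    simp only [hV, fixedPointsIncl_seqAvg, mul_smul_comm, Finset.mul_sum, hcomm, hcomm1,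
      inv_card_smul_sum_const]
  have hZl (g : G) (a : A) : star (V g) * ι a = star (v g) * ι a := by
    have h := congrArg star (hVr g (star a))
    rwa [star_mul, star_mul, ← ι_star, star_star] at h
  have hd (g : G) (d : fixedPoints α) : v g * ι (d : A) = ι (d : A) * v g := by
    rw [hcomm1, d.2 g]
  have hVd (g : G) (d : fixedPoints α) : V g * ι (d : A) = ι (d : A) * V g := by
    rw [hVl, hVr, hd]
  have hZd (g : G) (d : fixedPoints α) : star (V g) * ι (d : A) = ι (d : A) * star (V g) := by
    have h := congrArg star (hVd g (star d))
    rw [star_mul, star_mul] at h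
    exact (star_star (ι (d : A)) ▸ h).symm
  -- The adjoint is taken because a v_g = v_g α_g(a) gives v_g* a v_g = α_g(a).
  refine (isApproximatelyRepresentable_iff α hD).2 ⟨fun g => star (seqAvg α (v g)), ?_, ?_⟩
  · refine ⟨fun g => mem_centralSeq_iff.2 fun d => fixedPointsIncl_injective α ?_,
      fun d => fixedPointsIncl_injective α ?_, fun g k d => fixedPointsIncl_injective α ?_,
      fun g d => fixedPointsIncl_injective α ?_, fun g d => fixedPointsIncl_injective α ?_⟩ <;>
      simp only [map_mul, map_star, fixedPointsIncl_ι, star_star]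
    · exact (hZd g d).symm
    · calc star (V 1) * ι (d : A) = star (v 1) * (v 1 * ι (d : A)) := by rw [hZl, hone]
        _ = ι (d : A) := by rw [← mul_assoc, hsm]
    -- The adjoint of the desired relation, with d* on the left. Since v_g commutes with fixed
    -- points, d* can be moved to the right, where `hmul` applies; commutativity of `G` corrects the
    -- order.
    · have h1 : ι (star (d : A)) * V (g * k) = ι (star (d : A)) * (V k * V g) := by
        have hd' (g : G) := hd g (star d)
        have hcoe : ((star d : fixedPoints α) : A) = star (d : A) := rfl
        rw [hcoe] at hd'
        rw [hVr, ← hd', mul_comm g k, hmul, ← mul_assoc (ι _), hVr, ← hd', mul_assoc (v k) (ι _),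
          hVr, ← hd', mul_assoc]
      have h2 := congrArg star h1
      rwa [star_mul, star_mul, star_mul, ← ι_star, star_star] at h2
    · change V g * star (V g) * ι (d : A) = ι (d : A)
      rw [mul_assoc, hZd, ← mul_assoc, hVl, mul_assoc, ← hZd, hZl, ← mul_assoc, hms]
    · change star (V g) * V g * ι (d : A) = ι (d : A)
      rw [mul_assoc, hVl, hd, ← mul_assoc, hZl, mul_assoc, ← hd, ← mul_assoc, hsm]
  · intro g a
    rw [map_star, star_star]
    change _ = star (V g) * ι a * V g
    rw [mul_assoc, hVr, ← mul_assoc, hZl, mul_assoc, hcomm1, ← mul_assoc, hsm]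

theorem isApproximatelyRepresentable_iff_hasRohlinProperty_dualAction
    (hA : ∃ e : SeqAlg A, IsSeqUnit e) :
    IsApproximatelyRepresentable α ↔ HasRohlinProperty (dualAction α) := by
  refine ⟨hasRohlinProperty_dualAction_of_isApproximatelyRepresentable α hA, fun h => ?_⟩
  have hD : ∃ e : SeqAlg (fixedPoints α), IsSeqUnit e := hA.imp' (seqAvg α) fun _ he => he.seqAvg α
  have hB : ∃ e : SeqAlg (crossedProduct α), IsSeqUnit e :=
    hA.imp' (seqMonomial α 1) fun _ he => he.seqMonomial_one α
  obtain ⟨u, hu, hγ⟩ :=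
    (hasRohlinProperty_iff_exists_actsAsRep isPerfectPairing_id (dualAction α) hB).1 h
  exact isApproximatelyRepresentable_of_actsAsRep_seqMonomial α hD
    (actsAsRep_seqMonomial_seqCoeff α hu hγ)

end RepresentableDual

end RohlinDuality

end

theorem proposition4p3 {G A : Type*} [CommGroup G] [Fintype G]
    [NonUnitalCStarAlgebra A] [PartialOrder A] [StarOrderedRing A]
    (hA : RohlinDuality.IsSigmaUnital A) (α : G →* (A ≃⋆ₐ[ℂ] A)) :
    (RohlinDuality.HasRohlinProperty α ↔
      RohlinDuality.IsApproximatelyRepresentable (RohlinDuality.dualAction α)) ∧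
    (RohlinDuality.IsApproximatelyRepresentable α ↔
      RohlinDuality.HasRohlinProperty (RohlinDuality.dualAction α)) := by
  obtain ⟨h, hb, hl⟩ := hA
  have hA := RohlinDuality.exists_isSeqUnit_of_tendsto (fun n => (hb n).2) (fun a => (hl a).1)
    fun a => (hl a).2
  exact ⟨RohlinDuality.hasRohlinProperty_iff_isApproximatelyRepresentable_dualAction α hA,
    RohlinDuality.isApproximatelyRepresentable_iff_hasRohlinProperty_dualAction α hA⟩
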